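/- Let $v_i\in\mathbb R^p$, $i\in\mathcal S$, be a finite nonempty family of vectors, let $g:\mathbb R^p\to\mathbb R$ be convex and continuously differentiable, and put $f(x)=\max_{i\in\mathcal S}\langle v_i,x\rangle+g(x)$. The pattern of $x$ is $I(x)=\operatorname{argmax}_{i\in\mathcal S}\langle v_i,x\rangle\subset\mathcal S$ (the set of all maximizing indices), and $\mathfrak P=\{I(x):x\in\mathbb R^p\}$. Let $X_1,X_2,\dots$ be i.i.d. centered random vectors in $\mathbb R^p$ with positive definite covariance matrix $C$, and let $\varepsilon_1,\varepsilon_2,\dots$ be i.i.d. centered random variables with variance $\sigma^2>0$, the sequence $(\varepsilon_i)$ being independent of $(X_i)$. Fix $\beta^0\in\mathbb R^p$ and put $y_i=\langle X_i,\beta^0\rangle+\varepsilon_i$. For every $n$ let $\hat\beta_n$ be a random vector which almost surely is a minimizer (whenever one exists) of $$\beta\mapsto \tfrac12\sum_{i=1}^n (y_i-\langle X_i,\beta\rangle)^2+n^{1/2}f(\beta),$$ and put $\hat u_n=\sqrt n(\hat\beta_n-\beta^0)$. Let $W\sim\mathcal N(0,\sigma^2C)$ and let $\hat u$ be almost surely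 the minimizer of $$V(u)=\tfrac12u^TCu-u^TW+f'(\beta^0;u),\qquad f'(\beta^0;u)=\lim_{t\downarrow0}\frac{f(\beta^0+tu)-f(\beta^0)}{t}.$$ Then for every convex set $\mathcal K\subset\mathbb R^p$, $\mathbb P[\hat u_n\in\mathcal K]\to\mathbb P[\hat u\in\mathcal K]$ as $n\to\infty$. In particular $\hat u_n$ converges weakly in pattern to $\hat u$: for every pattern $\mathfrak p\in\mathfrak P$, $$\mathbb P[I(\hat u_n)=\mathfrak p]\to\mathbb P[I(\hat u)=\mathfrak p].$$ The same holds for the pattern map $x\mapsto\operatorname{argmax}_{j\in\mathcal T}\langle w_j,x\rangle$, and its patterns, of any other finite nonempty family $(w_j)_{j\in\mathcal T}$ of vectors in $\mathbb R^p$. (If the event $\{\hat u_n\in\mathcal K\}$ is not measurable, its probability is understood as outer probability.) -/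

import Mathlib

open MeasureTheory ProbabilityTheory Filter
open scoped Topology

namespace PatternConv

noncomputable section

/-- The polyhedral function `h x = max {⟪v i, x⟫ : i}` of a finite nonempty family of vectors. -/
def polyMax {p : ℕ} {ι : Type*} [Fintype ι] [Nonempty ι] (v : ι → EuclideanSpace ℝ (Fin p))
    (x : EuclideanSpace ℝ (Fin p)) : ℝ :=
  Finset.univ.sup' Finset.univ_nonempty (fun i => inner ℝ (v i) x)

/-- The penalty `f x = max {⟪v i, x⟫ : i} + g x`. -/
def penalty {p : ℕ} {ι : Type*} [Fintype ι] [Nonempty ι] (v : ι → EuclideanSpace ℝ (Fin p))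
    (g : EuclideanSpace ℝ (Fin p) → ℝ) (x : EuclideanSpace ℝ (Fin p)) : ℝ :=
  polyMax v x + g x

/-- The pattern `I x = argmax_i ⟪v i, x⟫`, the set of all maximizing indices. -/
def pattern {p : ℕ} {ι : Type*} (v : ι → EuclideanSpace ℝ (Fin p))
    (x : EuclideanSpace ℝ (Fin p)) : Set ι :=
  {i | ∀ j, inner ℝ (v j) x ≤ inner ℝ (v i) x}

/-- The set of all patterns: the image of the pattern map. -/
def patternSet {p : ℕ} {ι : Type*} (v : ι → EuclideanSpace ℝ (Fin p)) : Set (Set ι) :=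
  Set.range (pattern v)

/-- Weak convergence in pattern of random vectors `U n` to `u`. -/
def TendstoInPattern {p : ℕ} {ι Ω Ω' : Type*} [MeasurableSpace Ω] [MeasurableSpace Ω']
    (v : ι → EuclideanSpace ℝ (Fin p))
    (U : ℕ → Ω → EuclideanSpace ℝ (Fin p)) (u : Ω' → EuclideanSpace ℝ (Fin p))
    (P : Measure Ω) (P' : Measure Ω') : Prop :=
  ∀ 𝔭 ∈ patternSet v,
    Tendsto (fun n => P {ω | pattern v (U n ω) = 𝔭}) atTop (𝓝 (P' {ω | pattern v (u ω) = 𝔭}))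

/-- The directional derivative `f'(x; u) = lim_{t ↓ 0} (f (x + t u) - f x) / t`. -/
def dirDeriv {p : ℕ} (f : EuclideanSpace ℝ (Fin p) → ℝ) (x u : EuclideanSpace ℝ (Fin p)) : ℝ :=
  limUnder (𝓝[>] (0 : ℝ)) (fun t => (f (x + t • u) - f x) / t)

/-- For a convex real-valued function the limit defining `dirDeriv` exists. -/
theorem tendsto_dirDeriv {p : ℕ} {f : EuclideanSpace ℝ (Fin p) → ℝ}
    (hf : ConvexOn ℝ Set.univ f) (x u : EuclideanSpace ℝ (Fin p)) :
    Tendsto (fun t : ℝ => (f (x + t • u) - f x) / t) (𝓝[>] 0) (𝓝 (dirDeriv f x u)) := by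
  have hc : ConvexOn ℝ Set.univ (fun t : ℝ => f (x + t • u)) := by
    have h := hf.comp_affineMap (AffineMap.lineMap x (x + u) : ℝ →ᵃ[ℝ] _)
    have e : (fun t : ℝ => f (x + t • u)) =
        f ∘ (AffineMap.lineMap x (x + u) : ℝ →ᵃ[ℝ] EuclideanSpace ℝ (Fin p)) := by
      funext t
      simp [AffineMap.lineMap_apply, add_comm]
    rw [e]
    simpa using h
  have h1 := hc.hasDerivWithinAt_rightDeriv_of_mem_interior (x := 0) (by simp)
  rw [hasDerivWithinAt_iff_tendsto_slope' (by simp)] at h1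
  refine tendsto_nhds_limUnder ⟨_, h1.congr fun t => ?_⟩
  simp [slope_def_field]

/-- The response `y_i = ⟪X_i, β⁰⟫ + ε_i` of the linear model. -/
def response {p : ℕ} (β₀ : EuclideanSpace ℝ (Fin p)) (x : ℕ → EuclideanSpace ℝ (Fin p))
    (e : ℕ → ℝ) (i : ℕ) : ℝ :=
  inner ℝ (x i) β₀ + e i

/-- The penalized least squares objective `½ ‖y - X β‖² + √n f β`, where the rows of the
`n × p` design matrix `X` are `x 0, …, x (n - 1)` and `y` is the response vector. -/
def objective {p : ℕ} (f : EuclideanSpace ℝ (Fin p) → ℝ) (β₀ : EuclideanSpace ℝ (Fin p))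
    (x : ℕ → EuclideanSpace ℝ (Fin p)) (e : ℕ → ℝ) (n : ℕ)
    (β : EuclideanSpace ℝ (Fin p)) : ℝ :=
  1 / 2 * ∑ i ∈ Finset.range n, (response β₀ x e i - inner ℝ (x i) β) ^ 2 + √(n : ℝ) * f β

/-- The limiting objective `V u = ½ uᵀ C u - uᵀ w + f'(β⁰; u)`. -/
def limitObjective {p : ℕ} (f : EuclideanSpace ℝ (Fin p) → ℝ) (β₀ : EuclideanSpace ℝ (Fin p))
    (C : Matrix (Fin p) (Fin p) ℝ) (w u : EuclideanSpace ℝ (Fin p)) : ℝ :=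
  1 / 2 * (u ⬝ᵥ C.mulVec u) - inner ℝ u w + dirDeriv f β₀ u

end

end PatternConv

namespace PatternConv

/-! ### Polyhedral functions: local structure and pattern cells. -/

section PolyMax

variable {p : ℕ} {ι : Type*} [Fintype ι] [Nonempty ι]

/-! Weak convergence of `û_n` alone does not give convergence on every convex set, since the law of
`û` may charge lower-dimensional faces. The proof therefore transfers the event from `û_n` to the
linear term of the limiting problem, which has a density in the limit.

Let `h` be the maximum over the vectors active at `β₀`, `T` the operator of `C`, `S_n` the empirical
second moment operator and `Z_n` the normalized score. Near `β₀` the polyhedral part of the penalty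
is exactly its value at `β₀` plus `h` of the increment, and `h` is positively homogeneous. So once
`β̂_n` is close to `β₀`, the first order condition reads `Y_n - T û_n ∈ ∂h(û_n)` with `Y_n = Z_n +
(T - S_n) û_n - ∇g(β̂_n)`. This is the optimality condition of the limiting problem, without error,
with linear term `Y_n` in place of `W - ∇g(β₀)` (`isSubgradient_of_isMinOn_objective`,
`mem_solutionSet_iff_of_isMinOn_objective`). As `T` is positive definite, solutions are unique, and
`û_n ∈ K` holds iff `Y_n ∈ A := (T + ∂h)(K)`.

The set `A` has Lebesgue-null frontier: `∂h` is constant on each of the finitely many pattern cells,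
so `A` is a finite union of convex sets (`volume_frontier_solutionSet`). By the central limit
theorem, the strong law and Slutsky, `Y_n` converges in distribution to `W - ∇g(β₀)`, whose law is
absolutely continuous. The portmanteau theorem (`tendsto_measure_of_ae_iff`) then gives the claim,
and patterns follow because pattern cells are convex. -/

theorem inner_le_polyMax (v : ι → EuclideanSpace ℝ (Fin p)) (x : EuclideanSpace ℝ (Fin p))
    (i : ι) : inner ℝ (v i) x ≤ polyMax v x :=
  Finset.le_sup' (fun i => inner ℝ (v i) x) (Finset.mem_univ i)

theorem polyMax_le_iff {v : ι → EuclideanSpace ℝ (Fin p)} {x : EuclideanSpace ℝ (Fin p)}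
    {a : ℝ} : polyMax v x ≤ a ↔ ∀ i, inner ℝ (v i) x ≤ a := by
  simp [polyMax]

theorem exists_inner_eq_polyMax (v : ι → EuclideanSpace ℝ (Fin p))
    (x : EuclideanSpace ℝ (Fin p)) : ∃ i, inner ℝ (v i) x = polyMax v x := by
  obtain ⟨i, -, hi⟩ := Finset.exists_mem_eq_sup' Finset.univ_nonempty (fun i => inner ℝ (v i) x)
  exact ⟨i, hi.symm⟩

theorem mem_pattern_iff {v : ι → EuclideanSpace ℝ (Fin p)} {x : EuclideanSpace ℝ (Fin p)}
    {i : ι} : i ∈ pattern v x ↔ inner ℝ (v i) x = polyMax v x := by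
  constructor
  · intro h
    exact le_antisymm (inner_le_polyMax v x i) (polyMax_le_iff.2 h)
  · intro h j
    exact h ▸ inner_le_polyMax v x j

instance nonempty_pattern (v : ι → EuclideanSpace ℝ (Fin p)) (x : EuclideanSpace ℝ (Fin p)) :
    Nonempty (pattern v x) := by
  obtain ⟨i, hi⟩ := exists_inner_eq_polyMax v x
  exact ⟨i, mem_pattern_iff.2 hi⟩

noncomputable instance fintypePattern (v : ι → EuclideanSpace ℝ (Fin p))
    (x : EuclideanSpace ℝ (Fin p)) : Fintype (pattern v x) :=
  Fintype.ofFinite _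

/-- The subfamily of the vectors that are active at `x`. -/
def activeFamily (v : ι → EuclideanSpace ℝ (Fin p)) (x : EuclideanSpace ℝ (Fin p)) :
    pattern v x → EuclideanSpace ℝ (Fin p) :=
  fun i => v i

theorem continuous_polyMax (v : ι → EuclideanSpace ℝ (Fin p)) : Continuous (polyMax v) := by
  unfold polyMax
  exact Continuous.finset_sup'_apply _ fun i _ => by fun_prop

theorem convexOn_polyMax (v : ι → EuclideanSpace ℝ (Fin p)) :
    ConvexOn ℝ Set.univ (polyMax v) := by
  refine ⟨convex_univ, fun x _ y _ a b ha hb _ => polyMax_le_iff.2 fun i => ?_⟩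
  rw [inner_add_right, real_inner_smul_right, real_inner_smul_right, smul_eq_mul, smul_eq_mul]
  exact add_le_add (mul_le_mul_of_nonneg_left (inner_le_polyMax v x i) ha)
    (mul_le_mul_of_nonneg_left (inner_le_polyMax v y i) hb)

theorem polyMax_smul (v : ι → EuclideanSpace ℝ (Fin p)) {t : ℝ} (ht : 0 ≤ t)
    (x : EuclideanSpace ℝ (Fin p)) : polyMax v (t • x) = t * polyMax v x := by
  apply le_antisymm
  · refine polyMax_le_iff.2 fun i => ?_
    rw [real_inner_smul_right]
    exact mul_le_mul_of_nonneg_left (inner_le_polyMax v x i) ht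
  · obtain ⟨i, hi⟩ := exists_inner_eq_polyMax v x
    rw [← hi, ← real_inner_smul_right]
    exact inner_le_polyMax v _ i

/-- Near `x`, the function `polyMax v` is affine-homogeneous, with the active family at `x`. -/
theorem polyMax_add_eq (v : ι → EuclideanSpace ℝ (Fin p)) (x : EuclideanSpace ℝ (Fin p)) :
    ∃ δ > 0, ∀ y, ‖y‖ < δ →
      polyMax v (x + y) = polyMax v x + polyMax (activeFamily v x) y := by
  obtain ⟨i₀, hi₀⟩ := exists_inner_eq_polyMax v x
  have hev : ∀ᶠ y in 𝓝 (0 : EuclideanSpace ℝ (Fin p)), ∀ i, i ∉ pattern v x →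
      inner ℝ (v i) (x + y) < inner ℝ (v i₀) (x + y) := by
    refine eventually_all.2 fun i => ?_
    by_cases hi : i ∈ pattern v x
    · exact .of_forall fun y h => absurd hi h
    · have hlt : inner ℝ (v i) (x + 0) < inner ℝ (v i₀) (x + 0) := by
        rw [add_zero, hi₀]
        exact lt_of_le_of_ne (inner_le_polyMax v x i) fun h => hi (mem_pattern_iff.2 h)
      have hc : ∀ j, Continuous fun y => inner ℝ (v j) (x + y) := fun j => by fun_prop
      filter_upwards [(hc i).continuousAt.eventually_lt (hc i₀).continuousAt hlt] with y hy _
      exact hy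
  obtain ⟨δ, hδ, hball⟩ := Metric.eventually_nhds_iff.1 hev
  refine ⟨δ, hδ, fun y hy => ?_⟩
  have hy' := hball (by simpa using hy)
  have hact : ∀ i ∈ pattern v x,
      inner ℝ (v i) (x + y) ≤ polyMax v x + polyMax (activeFamily v x) y := fun i hi => by
    rw [inner_add_right, mem_pattern_iff.1 hi]
    have h := inner_le_polyMax (activeFamily v x) y ⟨i, hi⟩
    simp only [activeFamily] at h
    linarith
  apply le_antisymm
  · refine polyMax_le_iff.2 fun i => ?_
    by_cases hi : i ∈ pattern v x
    · exact hact i hi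
    · exact (hy' i hi).le.trans (hact i₀ (mem_pattern_iff.2 hi₀))
  · obtain ⟨⟨i, hi⟩, h⟩ := exists_inner_eq_polyMax (activeFamily v x) y
    rw [← h, ← mem_pattern_iff.1 hi, activeFamily, ← inner_add_right]
    exact inner_le_polyMax v _ i

/-- An index maximal at both ends is maximal at every convex combination, and another index can tie
with it there only if it ties at each end carrying positive weight. -/
theorem convex_setOf_pattern_eq (v : ι → EuclideanSpace ℝ (Fin p)) (s : Set ι) :
    Convex ℝ {x | pattern v x = s} := by
  intro x hx y hy a b ha hb hab
  simp only [Set.mem_ofPred_eq] at hx hy ⊢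
  subst hx
  obtain ⟨⟨k, hk⟩⟩ := nonempty_pattern v x
  have hk' : k ∈ pattern v y := hy ▸ hk
  have hle : ∀ i, inner ℝ (v i) (a • x + b • y) ≤ inner ℝ (v k) (a • x + b • y) := fun i => by
    simp only [inner_add_right, real_inner_smul_right]
    exact add_le_add (mul_le_mul_of_nonneg_left (hk i) ha) (mul_le_mul_of_nonneg_left (hk' i) hb)
  have hmax : inner ℝ (v k) (a • x + b • y) = polyMax v (a • x + b • y) :=
    mem_pattern_iff.1 hle
  ext i
  rw [mem_pattern_iff, ← hmax]
  constructor
  · intro h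
    simp only [inner_add_right, real_inner_smul_right] at h
    have h1 := mul_le_mul_of_nonneg_left (hk i) ha
    have h2 := mul_le_mul_of_nonneg_left (hk' i) hb
    rcases ha.eq_or_lt with rfl | ha
    · obtain rfl : b = 1 := by linarith
      rw [← hy, mem_pattern_iff, ← mem_pattern_iff.1 hk']
      linarith
    · rw [mem_pattern_iff, ← mem_pattern_iff.1 hk]
      have : a * inner ℝ (v i) x = a * inner ℝ (v k) x := by linarith
      exact mul_left_cancel₀ ha.ne' this
  · intro hi
    have hi' : i ∈ pattern v y := hy ▸ hi
    simp only [inner_add_right, real_inner_smul_right]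
    rw [mem_pattern_iff.1 hi, mem_pattern_iff.1 hi', mem_pattern_iff.1 hk,
      mem_pattern_iff.1 hk']

end PolyMax

/-! ### Subgradients and first order conditions. -/

section Subgradient

variable {E : Type*} [NormedAddCommGroup E] [InnerProductSpace ℝ E]

/-- `z` is a subgradient of `h` at `x`. -/
def IsSubgradient (h : E → ℝ) (x z : E) : Prop :=
  ∀ y, h x + inner ℝ z (y - x) ≤ h y

/-- One-sided difference quotients suffice. This serves both the gradient inequality and the
optimality condition. -/
theorem hasFDerivAt_apply_le {φ : E → ℝ} {φ' : E →L[ℝ] ℝ} {x d : E} {c : ℝ}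
    (hφ : HasFDerivAt φ φ' x)
    (h : ∀ᶠ t : ℝ in 𝓝[>] 0, φ (x + t • d) - φ x ≤ t * c) : φ' d ≤ c := by
  have h1 : HasDerivAt (fun t : ℝ => φ (x + t • d)) (φ' d) 0 := by
    have h0 : HasDerivAt (fun t : ℝ => x + t • d) d 0 := by
      simpa using ((hasDerivAt_id (0 : ℝ)).smul_const d).const_add x
    have hφ0 : HasFDerivAt φ φ' ((fun t : ℝ => x + t • d) 0) := by simpa using hφ
    exact hφ0.comp_hasDerivAt 0 h0
  have h2 := (hasDerivAt_iff_tendsto_slope.1 h1).mono_left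
    (nhdsWithin_mono (s := Set.Ioi (0 : ℝ)) 0 (fun t (ht : 0 < t) => ht.ne'))
  refine le_of_tendsto h2 ?_
  filter_upwards [h, self_mem_nhdsWithin] with t ht ht0
  have ht0 : 0 < t := ht0
  rw [slope_def_field, sub_zero, zero_smul, add_zero, div_le_iff₀ ht0, mul_comm]
  exact ht

theorem add_fderiv_le_of_convexOn {g : E → ℝ} (hg : ConvexOn ℝ Set.univ g) {x : E}
    {g' : E →L[ℝ] ℝ} (hd : HasFDerivAt g g' x) (y : E) : g x + g' (y - x) ≤ g y := by
  suffices g' (y - x) ≤ g y - g x by linarith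
  refine hasFDerivAt_apply_le hd ?_
  filter_upwards [Ioo_mem_nhdsGT (zero_lt_one (α := ℝ))] with t ht
  have h := hg.2 (Set.mem_univ x) (Set.mem_univ y) (sub_nonneg.2 ht.2.le) ht.1.le (by ring)
  have e : x + t • (y - x) = (1 - t) • x + t • y := by
    rw [smul_sub, sub_smul, one_smul]; abel
  rw [e]
  simp only [smul_eq_mul] at h
  linarith

/-- First order condition for a minimizer of the sum of a smooth and a convex function. -/
theorem IsSubgradient.of_isLocalMin {φ h : E → ℝ} (hh : ConvexOn ℝ Set.univ h) {x z : E}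
    (hφ : HasFDerivAt φ (-innerSL ℝ z) x) (hmin : IsLocalMin (fun y => φ y + h y) x) :
    IsSubgradient h x z := by
  intro y
  have hφn : HasFDerivAt (fun y => -φ y) (innerSL ℝ z) x := by
    have h := hφ.neg
    rw [neg_neg] at h
    exact h
  have key : innerSL ℝ z (y - x) ≤ h y - h x := by
    refine hasFDerivAt_apply_le hφn ?_
    have hc : Tendsto (fun t : ℝ => x + t • (y - x)) (𝓝[>] 0) (𝓝 x) := by
      have : Continuous fun t : ℝ => x + t • (y - x) := by fun_prop
      simpa using (this.tendsto 0).mono_left nhdsWithin_le_nhds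
    filter_upwards [Ioo_mem_nhdsGT (zero_lt_one (α := ℝ)), hc.eventually hmin] with t ht hm
    have h1 := hh.2 (Set.mem_univ x) (Set.mem_univ y) (sub_nonneg.2 ht.2.le) ht.1.le (by ring)
    have e : x + t • (y - x) = (1 - t) • x + t • y := by
      rw [smul_sub, sub_smul, one_smul]; abel
    rw [e] at hm ⊢
    simp only [smul_eq_mul] at h1
    linarith
  rw [innerSL_apply_apply] at key
  linarith

end Subgradient

/-! ### Stationary points of the limiting problem and the linear terms producing them. -/

section SolutionSet

variable {p : ℕ} {ι : Type*} [Fintype ι] [Nonempty ι]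

/-- The subdifferential of `polyMax v` depends on the pattern only. -/
theorem IsSubgradient.of_pattern_eq {v : ι → EuclideanSpace ℝ (Fin p)}
    {x y z : EuclideanSpace ℝ (Fin p)} (hxy : pattern v x = pattern v y)
    (hz : IsSubgradient (polyMax v) x z) : IsSubgradient (polyMax v) y z := by
  obtain ⟨δ, hδ, hloc⟩ := polyMax_add_eq v x
  have hact : polyMax (activeFamily v x) (x - y) = polyMax v x - polyMax v y := by
    have hi : ∀ i : pattern v x, inner ℝ (activeFamily v x i) (x - y) =
        polyMax v x - polyMax v y := fun i => by
      rw [activeFamily, inner_sub_right, mem_pattern_iff.1 i.2, mem_pattern_iff.1 (hxy ▸ i.2)]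
    obtain ⟨i, hi'⟩ := exists_inner_eq_polyMax (activeFamily v x) (x - y)
    rw [← hi', hi]
  -- Stepping from `x` away from `y`, the function is still affine with the slope it has between `y`
  -- and `x`. The subgradient inequality there bounds `⟪z, x - y⟫` from above, which moves the base
  -- point to `y`.
  obtain ⟨t, ht, hlt⟩ : ∃ t : ℝ, 0 < t ∧ ‖t • (x - y)‖ < δ := by
    have hc : Tendsto (fun t : ℝ => ‖t • (x - y)‖) (𝓝[>] 0) (𝓝 0) := by
      have : Continuous fun t : ℝ => ‖t • (x - y)‖ := by fun_prop
      simpa using (this.tendsto 0).mono_left nhdsWithin_le_nhds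
    obtain ⟨t, h1, h2⟩ := ((hc.eventually (gt_mem_nhds hδ)).and self_mem_nhdsWithin).exists
    exact ⟨t, h2, h1⟩
  have h1 := hz (x + t • (x - y))
  rw [hloc _ hlt, polyMax_smul _ ht.le, hact, add_sub_cancel_left, real_inner_smul_right] at h1
  have h2 : inner ℝ z (x - y) ≤ polyMax v x - polyMax v y :=
    le_of_mul_le_mul_left (by linarith) ht
  intro w
  have h3 := hz w
  simp only [inner_sub_right] at h2 h3 ⊢
  linarith

/-- The set of those `w` for which `u ↦ ½ ⟪u, T u⟫ - ⟪u, w⟫ + polyMax v u` has a stationary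
point in `K`. -/
def solutionSet (v : ι → EuclideanSpace ℝ (Fin p))
    (T : EuclideanSpace ℝ (Fin p) →L[ℝ] EuclideanSpace ℝ (Fin p))
    (K : Set (EuclideanSpace ℝ (Fin p))) : Set (EuclideanSpace ℝ (Fin p)) :=
  {w | ∃ u ∈ K, IsSubgradient (polyMax v) u (w - T u)}

/-- On one cell the subdifferential is a fixed convex set, so this set is the Minkowski sum of it
and a linear image of a convex set. -/
theorem convex_solutionSet_inter_pattern (v : ι → EuclideanSpace ℝ (Fin p))
    (T : EuclideanSpace ℝ (Fin p) →L[ℝ] EuclideanSpace ℝ (Fin p))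
    {K : Set (EuclideanSpace ℝ (Fin p))} (hK : Convex ℝ K) (s : Set ι) :
    Convex ℝ (solutionSet v T (K ∩ {u | pattern v u = s})) := by
  rintro w₁ ⟨u₁, ⟨hu₁, hs₁⟩, h₁⟩ w₂ ⟨u₂, ⟨hu₂, hs₂⟩, h₂⟩ a b ha hb hab
  have hs := convex_setOf_pattern_eq v s hs₁ hs₂ ha hb hab
  refine ⟨a • u₁ + b • u₂, ⟨hK hu₁ hu₂ ha hb hab, hs⟩, fun y => ?_⟩
  have k₁ := h₁.of_pattern_eq (hs₁.trans hs.symm) y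
  have k₂ := h₂.of_pattern_eq (hs₂.trans hs.symm) y
  have e : a • w₁ + b • w₂ - T (a • u₁ + b • u₂) = a • (w₁ - T u₁) + b • (w₂ - T u₂) := by
    simp only [map_add, map_smul, smul_sub]; abel
  rw [e, inner_add_left, real_inner_smul_left, real_inner_smul_left]
  have m₁ := mul_le_mul_of_nonneg_left k₁ ha
  have m₂ := mul_le_mul_of_nonneg_left k₂ hb
  obtain rfl : b = 1 - a := by linarith
  linarith

/-- The frontier of a finite union lies in the union of the frontiers, and frontiers of convex sets
are null. -/
theorem volume_frontier_solutionSet (v : ι → EuclideanSpace ℝ (Fin p))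
    (T : EuclideanSpace ℝ (Fin p) →L[ℝ] EuclideanSpace ℝ (Fin p))
    {K : Set (EuclideanSpace ℝ (Fin p))} (hK : Convex ℝ K) :
    volume (frontier (solutionSet v T K)) = 0 := by
  have e : solutionSet v T K = ⋃ s : Set ι, solutionSet v T (K ∩ {u | pattern v u = s}) := by
    ext w
    simp only [solutionSet, Set.mem_iUnion, Set.mem_ofPred_eq, Set.mem_inter_iff]
    constructor
    · rintro ⟨u, hu, h⟩
      exact ⟨_, u, ⟨hu, rfl⟩, h⟩
    · rintro ⟨s, u, ⟨hu, -⟩, h⟩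
      exact ⟨u, hu, h⟩
  rw [e]
  refine measure_mono_null (t := ⋃ s : Set ι, frontier
    (solutionSet v T (K ∩ {u | pattern v u = s}))) ?_ ?_
  · intro w hw
    rw [frontier, closure_iUnion_of_finite] at hw
    obtain ⟨s, hs⟩ := Set.mem_iUnion.1 hw.1
    exact Set.mem_iUnion.2 ⟨s, hs, fun h => hw.2 (interior_mono (Set.subset_iUnion _ s) h)⟩
  · exact measure_iUnion_null fun s =>
      (convex_solutionSet_inter_pattern v T hK s).addHaar_frontier volume

/-- Monotonicity of the subdifferential contradicts positivity of `T` on `u₁ - u₂`. -/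
theorem IsSubgradient.unique {v : ι → EuclideanSpace ℝ (Fin p)}
    {T : EuclideanSpace ℝ (Fin p) →L[ℝ] EuclideanSpace ℝ (Fin p)}
    (hT : ∀ u, u ≠ 0 → 0 < inner ℝ (T u) u) {w u₁ u₂ : EuclideanSpace ℝ (Fin p)}
    (h₁ : IsSubgradient (polyMax v) u₁ (w - T u₁))
    (h₂ : IsSubgradient (polyMax v) u₂ (w - T u₂)) : u₁ = u₂ := by
  by_contra hne
  have h := hT (u₁ - u₂) (sub_ne_zero.2 hne)
  have k₁ := h₁ u₂
  have k₂ := h₂ u₁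
  simp only [map_sub, inner_sub_left, inner_sub_right] at h k₁ k₂
  linarith

theorem mem_solutionSet_iff {v : ι → EuclideanSpace ℝ (Fin p)}
    {T : EuclideanSpace ℝ (Fin p) →L[ℝ] EuclideanSpace ℝ (Fin p)}
    (hT : ∀ u, u ≠ 0 → 0 < inner ℝ (T u) u) {w u : EuclideanSpace ℝ (Fin p)}
    (h : IsSubgradient (polyMax v) u (w - T u)) {K : Set (EuclideanSpace ℝ (Fin p))} :
    w ∈ solutionSet v T K ↔ u ∈ K := by
  constructor
  · rintro ⟨u', hu', h'⟩
    rwa [h.unique hT h']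
  · exact fun hu => ⟨u, hu, h⟩

end SolutionSet

/-! ### Differential calculus of the penalty. -/

section Penalty

variable {p : ℕ} {ι : Type*} [Fintype ι] [Nonempty ι]

theorem hasFDerivAt_gradient {E : Type*} [NormedAddCommGroup E] [InnerProductSpace ℝ E]
    [CompleteSpace E] {g : E → ℝ} (hg : ContDiff ℝ 1 g) (x : E) :
    HasFDerivAt g (innerSL ℝ (gradient g x)) x :=
  ((hg.differentiable one_ne_zero) x).hasGradientAt

theorem continuous_gradient {E : Type*} [NormedAddCommGroup E] [InnerProductSpace ℝ E]
    [CompleteSpace E] {g : E → ℝ} (hg : ContDiff ℝ 1 g) : Continuous (gradient g) := by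
  unfold gradient
  exact (InnerProductSpace.toDual ℝ E).symm.continuous.comp (hg.continuous_fderiv one_ne_zero)

/-- For small `t` the difference quotient of the polyhedral part is constant, so only `g` requires a
limit. -/
theorem dirDeriv_penalty (v : ι → EuclideanSpace ℝ (Fin p)) {g : EuclideanSpace ℝ (Fin p) → ℝ}
    (hg : ContDiff ℝ 1 g) (x u : EuclideanSpace ℝ (Fin p)) :
    dirDeriv (penalty v g) x u =
      polyMax (activeFamily v x) u + inner ℝ (gradient g x) u := by
  refine Tendsto.limUnder_eq ?_
  obtain ⟨δ, hδ, hloc⟩ := polyMax_add_eq v x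
  have h1 : HasDerivAt (fun t : ℝ => g (x + t • u)) (inner ℝ (gradient g x) u) 0 := by
    have h0 : HasDerivAt (fun t : ℝ => x + t • u) u 0 := by
      simpa using ((hasDerivAt_id (0 : ℝ)).smul_const u).const_add x
    have hφ0 : HasFDerivAt g (innerSL ℝ (gradient g x)) ((fun t : ℝ => x + t • u) 0) := by
      simpa using hasFDerivAt_gradient hg x
    exact hφ0.comp_hasDerivAt 0 h0
  have h2 := (hasDerivAt_iff_tendsto_slope.1 h1).mono_left
    (nhdsWithin_mono (s := Set.Ioi (0 : ℝ)) 0 (fun t (ht : 0 < t) => ht.ne'))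
  have hc : Tendsto (fun t : ℝ => ‖t • u‖) (𝓝[>] 0) (𝓝 0) := by
    have : Continuous fun t : ℝ => ‖t • u‖ := by fun_prop
    simpa using (this.tendsto 0).mono_left nhdsWithin_le_nhds
  refine (h2.const_add (polyMax (activeFamily v x) u)).congr' ?_
  filter_upwards [hc.eventually (gt_mem_nhds hδ), self_mem_nhdsWithin] with t ht ht0
  have ht0 : 0 < t := ht0
  rw [slope_def_field, penalty, penalty, hloc _ ht, polyMax_smul _ ht0.le, sub_zero, zero_smul,
    add_zero]
  field_simp
  ring

theorem exists_isSubgradient_penalty (v : ι → EuclideanSpace ℝ (Fin p))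
    {g : EuclideanSpace ℝ (Fin p) → ℝ} (hgc : ConvexOn ℝ Set.univ g) (hg : ContDiff ℝ 1 g)
    (x : EuclideanSpace ℝ (Fin p)) : ∃ s, IsSubgradient (penalty v g) x s := by
  obtain ⟨i, hi⟩ := exists_inner_eq_polyMax v x
  refine ⟨v i + gradient g x, fun y => ?_⟩
  have h1 := inner_le_polyMax v y i
  have h2 := add_fderiv_le_of_convexOn hgc (hasFDerivAt_gradient hg x) y
  rw [innerSL_apply_apply] at h2
  simp only [penalty, inner_add_left, inner_sub_right] at h1 h2 ⊢
  linarith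

theorem hasFDerivAt_half_inner {E : Type*} [NormedAddCommGroup E] [InnerProductSpace ℝ E]
    {T : E →L[ℝ] E} (hT : ∀ x y, inner ℝ (T x) y = inner ℝ x (T y)) (x : E) :
    HasFDerivAt (fun u => 1 / 2 * inner ℝ (T u) u) (innerSL ℝ (T x)) x := by
  have h := ((T.hasFDerivAt (x := x)).inner ℝ (hasFDerivAt_id x)).const_mul (1 / 2 : ℝ)
  refine h.congr_fderiv (ContinuousLinearMap.ext fun d => ?_)
  simp [hT d x, real_inner_comm d (T x)]
  ring

end Penalty

/-! ### The rescaled objective: growth, existence and optimality. -/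

section Objective

variable {p : ℕ}

/-- The empirical second moment operator `n⁻¹ ∑ xᵢ xᵢᵀ`. -/
noncomputable def empiricalCov (x : ℕ → EuclideanSpace ℝ (Fin p)) (n : ℕ) :
    EuclideanSpace ℝ (Fin p) →L[ℝ] EuclideanSpace ℝ (Fin p) :=
  (n : ℝ)⁻¹ • ∑ i ∈ Finset.range n, InnerProductSpace.rankOne ℝ (x i) (x i)

/-- The normalized score `n^{-1/2} ∑ eᵢ xᵢ`. -/
noncomputable def score (x : ℕ → EuclideanSpace ℝ (Fin p)) (e : ℕ → ℝ) (n : ℕ) :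
    EuclideanSpace ℝ (Fin p) :=
  (√(n : ℝ))⁻¹ • ∑ i ∈ Finset.range n, e i • x i

theorem inner_empiricalCov (x : ℕ → EuclideanSpace ℝ (Fin p)) (n : ℕ)
    (u w : EuclideanSpace ℝ (Fin p)) : inner ℝ (empiricalCov x n u) w =
      (n : ℝ)⁻¹ * ∑ i ∈ Finset.range n, inner ℝ (x i) u * inner ℝ (x i) w := by
  simp [empiricalCov, sum_inner, real_inner_smul_left]

theorem empiricalCov_symm (x : ℕ → EuclideanSpace ℝ (Fin p)) (n : ℕ)
    (u w : EuclideanSpace ℝ (Fin p)) :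
    inner ℝ (empiricalCov x n u) w = inner ℝ u (empiricalCov x n w) := by
  rw [real_inner_comm _ u, inner_empiricalCov, inner_empiricalCov]
  simp only [mul_comm]

theorem inner_score (x : ℕ → EuclideanSpace ℝ (Fin p)) (e : ℕ → ℝ) (n : ℕ)
    (u : EuclideanSpace ℝ (Fin p)) : inner ℝ (score x e n) u =
      (√(n : ℝ))⁻¹ * ∑ i ∈ Finset.range n, e i * inner ℝ (x i) u := by
  simp [score, sum_inner, real_inner_smul_left]

theorem objective_eq (f : EuclideanSpace ℝ (Fin p) → ℝ) (β₀ : EuclideanSpace ℝ (Fin p))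
    (x : ℕ → EuclideanSpace ℝ (Fin p)) (e : ℕ → ℝ) {n : ℕ} (hn : 0 < n)
    (u : EuclideanSpace ℝ (Fin p)) :
    objective f β₀ x e n (β₀ + (√(n : ℝ))⁻¹ • u) =
      1 / 2 * ∑ i ∈ Finset.range n, e i ^ 2 + (1 / 2 * inner ℝ (empiricalCov x n u) u
        - inner ℝ (score x e n) u + √(n : ℝ) * f (β₀ + (√(n : ℝ))⁻¹ • u)) := by
  have hn' : (0 : ℝ) < n := by exact_mod_cast hn
  have hs : (√(n : ℝ))⁻¹ * (√(n : ℝ))⁻¹ = (n : ℝ)⁻¹ := by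
    rw [← mul_inv, Real.mul_self_sqrt hn'.le]
  have h : ∀ i, (response β₀ x e i - inner ℝ (x i) (β₀ + (√(n : ℝ))⁻¹ • u)) ^ 2 =
      e i ^ 2 - 2 * ((√(n : ℝ))⁻¹ * (e i * inner ℝ (x i) u)) +
        (n : ℝ)⁻¹ * (inner ℝ (x i) u * inner ℝ (x i) u) := fun i => by
    rw [response, inner_add_right, real_inner_smul_right, ← hs]
    ring
  rw [objective, inner_empiricalCov, inner_score]
  simp only [h, Finset.sum_add_distrib, Finset.sum_sub_distrib, ← Finset.mul_sum]
  ring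

/-- A subgradient at `β₀` bounds the rescaled penalty increment below by `⟪s, u⟫`, so the quadratic
term dominates. This yields both existence and the a priori bound on minimizers. -/
theorem objective_zero_add_le {f : EuclideanSpace ℝ (Fin p) → ℝ}
    {β₀ s : EuclideanSpace ℝ (Fin p)} (hs : IsSubgradient f β₀ s)
    (x : ℕ → EuclideanSpace ℝ (Fin p)) (e : ℕ → ℝ) {n : ℕ} (hn : 0 < n) {c : ℝ}
    (hc : ∀ u, c * ‖u‖ ^ 2 ≤ inner ℝ (empiricalCov x n u) u) (u : EuclideanSpace ℝ (Fin p)) :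
    objective f β₀ x e n β₀ + (c / 2 * ‖u‖ - (‖score x e n‖ + ‖s‖)) * ‖u‖ ≤
      objective f β₀ x e n (β₀ + (√(n : ℝ))⁻¹ • u) := by
  have hn' : 0 < √(n : ℝ) := Real.sqrt_pos.2 (by exact_mod_cast hn)
  have h0 := objective_eq f β₀ x e hn 0
  simp only [smul_zero, add_zero, inner_zero_right, mul_zero, sub_zero, zero_add] at h0
  rw [h0, objective_eq f β₀ x e hn u]
  have h1 := hs (β₀ + (√(n : ℝ))⁻¹ • u)
  rw [add_sub_cancel_left, real_inner_smul_right] at h1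
  have h2 := mul_le_mul_of_nonneg_left h1 hn'.le
  rw [mul_add, ← mul_assoc, mul_inv_cancel₀ hn'.ne', one_mul] at h2
  have h3 := real_inner_le_norm (score x e n) u
  have h4 := (abs_le.1 (abs_real_inner_le_norm s u)).1
  have h5 := hc u
  nlinarith

theorem continuous_objective {f : EuclideanSpace ℝ (Fin p) → ℝ} (hf : Continuous f)
    (β₀ : EuclideanSpace ℝ (Fin p)) (x : ℕ → EuclideanSpace ℝ (Fin p)) (e : ℕ → ℝ) (n : ℕ) :
    Continuous (objective f β₀ x e n) := by
  unfold objective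
  fun_prop

theorem exists_isMinOn_objective {f : EuclideanSpace ℝ (Fin p) → ℝ} (hf : Continuous f)
    {β₀ s : EuclideanSpace ℝ (Fin p)} (hs : IsSubgradient f β₀ s)
    (x : ℕ → EuclideanSpace ℝ (Fin p)) (e : ℕ → ℝ) {n : ℕ} (hn : 0 < n) {c : ℝ} (hc0 : 0 < c)
    (hc : ∀ u, c * ‖u‖ ^ 2 ≤ inner ℝ (empiricalCov x n u) u) :
    ∃ b, IsMinOn (objective f β₀ x e n) Set.univ b := by
  have hn' : 0 < √(n : ℝ) := Real.sqrt_pos.2 (by exact_mod_cast hn)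
  have hF : Continuous fun u : EuclideanSpace ℝ (Fin p) =>
      objective f β₀ x e n (β₀ + (√(n : ℝ))⁻¹ • u) :=
    (continuous_objective hf β₀ x e n).comp (by fun_prop)
  -- Outside the ball of radius `2 / c * (‖score‖ + ‖s‖)` the growth term is nonnegative, so no
  -- value there is below the one at `0`.
  obtain ⟨u, hu⟩ := hF.exists_forall_le' 0 (by
    refine mem_of_superset (isCompact_closedBall 0
      (2 / c * (‖score x e n‖ + ‖s‖))).compl_mem_cocompact fun u hu => ?_
    have h1 : 2 / c * (‖score x e n‖ + ‖s‖) < ‖u‖ := by simpa using hu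
    have h2 := objective_zero_add_le hs x e hn hc u
    have h3 : 0 ≤ (c / 2 * ‖u‖ - (‖score x e n‖ + ‖s‖)) * ‖u‖ := by
      refine mul_nonneg ?_ (norm_nonneg u)
      rw [div_mul_eq_mul_div, div_lt_iff₀ hc0] at h1
      linarith
    simp only [Set.mem_ofPred_eq, smul_zero, add_zero]
    linarith)
  refine ⟨β₀ + (√(n : ℝ))⁻¹ • u, isMinOn_univ_iff.2 fun b => ?_⟩
  have h := hu (√(n : ℝ) • (b - β₀))
  rwa [smul_smul (√(n : ℝ))⁻¹, inv_mul_cancel₀ hn'.ne', one_smul, add_sub_cancel] at h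

theorem norm_le_of_isMinOn_objective {f : EuclideanSpace ℝ (Fin p) → ℝ}
    {β₀ s : EuclideanSpace ℝ (Fin p)} (hs : IsSubgradient f β₀ s)
    (x : ℕ → EuclideanSpace ℝ (Fin p)) (e : ℕ → ℝ) {n : ℕ} (hn : 0 < n) {c : ℝ} (hc0 : 0 < c)
    (hc : ∀ u, c * ‖u‖ ^ 2 ≤ inner ℝ (empiricalCov x n u) u) {b : EuclideanSpace ℝ (Fin p)}
    (hb : IsMinOn (objective f β₀ x e n) Set.univ b) :
    ‖√(n : ℝ) • (b - β₀)‖ ≤ 2 / c * (‖score x e n‖ + ‖s‖) := by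
  have hn' : 0 < √(n : ℝ) := Real.sqrt_pos.2 (by exact_mod_cast hn)
  have h := objective_zero_add_le hs x e hn hc (√(n : ℝ) • (b - β₀))
  rw [smul_smul (√(n : ℝ))⁻¹, inv_mul_cancel₀ hn'.ne', one_smul, add_sub_cancel] at h
  have h1 := isMinOn_univ_iff.1 hb β₀
  by_contra! hlt
  have h2 : 0 < ‖√(n : ℝ) • (b - β₀)‖ := lt_of_le_of_lt (by positivity) hlt
  have h3 : 0 < (c / 2 * ‖√(n : ℝ) • (b - β₀)‖ - (‖score x e n‖ + ‖s‖)) *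
      ‖√(n : ℝ) • (b - β₀)‖ := by
    refine mul_pos ?_ h2
    rw [div_mul_eq_mul_div, div_lt_iff₀ hc0] at hlt
    linarith
  linarith

variable {ι : Type*} [Fintype ι] [Nonempty ι]

theorem continuous_penalty (v : ι → EuclideanSpace ℝ (Fin p))
    {g : EuclideanSpace ℝ (Fin p) → ℝ} (hg : Continuous g) : Continuous (penalty v g) :=
  (continuous_polyMax v).add hg

/-- First order condition for the rescaled minimizer of the objective. -/
theorem isSubgradient_of_isMinOn_objective (v : ι → EuclideanSpace ℝ (Fin p))
    {g : EuclideanSpace ℝ (Fin p) → ℝ} (hg : ContDiff ℝ 1 g) {β₀ : EuclideanSpace ℝ (Fin p)}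
    {δ : ℝ} (hδ : ∀ y, ‖y‖ < δ →
      polyMax v (β₀ + y) = polyMax v β₀ + polyMax (activeFamily v β₀) y)
    (x : ℕ → EuclideanSpace ℝ (Fin p)) (e : ℕ → ℝ) {n : ℕ} (hn : 0 < n)
    {b : EuclideanSpace ℝ (Fin p)}
    (hb : IsMinOn (objective (penalty v g) β₀ x e n) Set.univ b)
    (hbδ : ‖b - β₀‖ < δ) :
    IsSubgradient (polyMax (activeFamily v β₀)) (√(n : ℝ) • (b - β₀))
      (score x e n - empiricalCov x n (√(n : ℝ) • (b - β₀)) - gradient g b) := by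
  have hn' : 0 < √(n : ℝ) := Real.sqrt_pos.2 (by exact_mod_cast hn)
  set u := √(n : ℝ) • (b - β₀) with hu
  have hub : β₀ + (√(n : ℝ))⁻¹ • u = b := by
    rw [hu, smul_smul, inv_mul_cancel₀ hn'.ne', one_smul, add_sub_cancel]
  have hud : (√(n : ℝ))⁻¹ • u = b - β₀ := by rw [← hub, add_sub_cancel_left]
  have hgd : HasFDerivAt (fun y : EuclideanSpace ℝ (Fin p) =>
      √(n : ℝ) * g (β₀ + (√(n : ℝ))⁻¹ • y)) (innerSL ℝ (gradient g b)) u := by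
    have h0 : HasFDerivAt (fun y : EuclideanSpace ℝ (Fin p) => β₀ + (√(n : ℝ))⁻¹ • y)
        ((√(n : ℝ))⁻¹ • ContinuousLinearMap.id ℝ (EuclideanSpace ℝ (Fin p))) u :=
      ((hasFDerivAt_id u).const_smul (√(n : ℝ))⁻¹).const_add β₀
    have h1 : HasFDerivAt g (innerSL ℝ (gradient g b)) (β₀ + (√(n : ℝ))⁻¹ • u) := by
      rw [hub]; exact hasFDerivAt_gradient hg b
    have h2 := (h1.comp u h0).const_mul √(n : ℝ)
    refine h2.congr_fderiv (ContinuousLinearMap.ext fun d => ?_)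
    simp [← mul_assoc, mul_inv_cancel₀ hn'.ne']
  refine IsSubgradient.of_isLocalMin (φ := fun y => 1 / 2 * inner ℝ (empiricalCov x n y) y
    - inner ℝ (score x e n) y + √(n : ℝ) * g (β₀ + (√(n : ℝ))⁻¹ • y))
    (convexOn_polyMax _) ?_ ?_
  · have h := ((hasFDerivAt_half_inner (empiricalCov_symm x n) u).sub
      (innerSL ℝ (score x e n)).hasFDerivAt).add hgd
    refine h.congr_fderiv (ContinuousLinearMap.ext fun d => ?_)
    simp only [neg_apply, add_apply, sub_apply, innerSL_apply_apply, inner_sub_left]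
    ring
  · have hc : Continuous fun y : EuclideanSpace ℝ (Fin p) => ‖(√(n : ℝ))⁻¹ • y‖ := by fun_prop
    have hloc : ∀ y : EuclideanSpace ℝ (Fin p), ‖(√(n : ℝ))⁻¹ • y‖ < δ →
        objective (penalty v g) β₀ x e n (β₀ + (√(n : ℝ))⁻¹ • y) =
        (1 / 2 * ∑ i ∈ Finset.range n, e i ^ 2 + √(n : ℝ) * polyMax v β₀) +
        (1 / 2 * inner ℝ (empiricalCov x n y) y
          - inner ℝ (score x e n) y + √(n : ℝ) * g (β₀ + (√(n : ℝ))⁻¹ • y) +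
          polyMax (activeFamily v β₀) y) := fun y hy => by
      -- Homogeneity cancels `√n` against its inverse, leaving the unscaled active maximum.
      rw [objective_eq _ _ _ _ hn, penalty, hδ _ hy, polyMax_smul _ (by positivity)]
      field_simp
      ring
    filter_upwards [hc.continuousAt.eventually_lt_const (show ‖(√(n : ℝ))⁻¹ • u‖ < δ by rwa [hud])] with y hy
    have h1 := isMinOn_univ_iff.1 hb (β₀ + (√(n : ℝ))⁻¹ • y)
    rw [hloc y hy] at h1
    have h2 := hloc u (by rw [hud]; exact hbδ)
    rw [hub] at h2
    rw [hub]
    linarith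

/-- First order condition for the minimizer of the limiting objective. -/
theorem isSubgradient_of_isMinOn_limitObjective (v : ι → EuclideanSpace ℝ (Fin p))
    {g : EuclideanSpace ℝ (Fin p) → ℝ} (hg : ContDiff ℝ 1 g) {β₀ : EuclideanSpace ℝ (Fin p)}
    {C : Matrix (Fin p) (Fin p) ℝ} (hC : C.IsHermitian) {w u : EuclideanSpace ℝ (Fin p)}
    (hu : IsMinOn (limitObjective (penalty v g) β₀ C w) Set.univ u) :
    IsSubgradient (polyMax (activeFamily v β₀)) u
      (w - gradient g β₀ - Matrix.toEuclideanCLM (𝕜 := ℝ) C u) := by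
  have hsymm : ∀ x y, inner ℝ (Matrix.toEuclideanCLM (𝕜 := ℝ) C x) y =
      inner ℝ x (Matrix.toEuclideanCLM (𝕜 := ℝ) C y) := fun x y => by
    have h := (hC.isSelfAdjoint.map (Matrix.toEuclideanCLM (𝕜 := ℝ) (n := Fin p))).adjoint_eq
    conv_lhs => rw [← h]
    exact ContinuousLinearMap.adjoint_inner_left _ _ _
  refine IsSubgradient.of_isLocalMin (φ := fun y =>
    1 / 2 * inner ℝ (Matrix.toEuclideanCLM (𝕜 := ℝ) C y) y - inner ℝ w y
      + inner ℝ (gradient g β₀) y) (convexOn_polyMax _) ?_ ?_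
  · have h := ((hasFDerivAt_half_inner hsymm u).sub (innerSL ℝ w).hasFDerivAt).add
      (innerSL ℝ (gradient g β₀)).hasFDerivAt
    refine h.congr_fderiv (ContinuousLinearMap.ext fun d => ?_)
    simp only [neg_apply, add_apply, sub_apply, innerSL_apply_apply, inner_sub_left]
    ring
  · refine .of_forall fun y => ?_
    have h := isMinOn_univ_iff.1 hu y
    have e : ∀ y, limitObjective (penalty v g) β₀ C w y =
        1 / 2 * inner ℝ (Matrix.toEuclideanCLM (𝕜 := ℝ) C y) y - inner ℝ w y
      + inner ℝ (gradient g β₀) y + polyMax (activeFamily v β₀) y := fun y => by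
      rw [limitObjective, dirDeriv_penalty v hg, hsymm, Matrix.inner_toEuclideanCLM, real_inner_comm w y]
      ring
    simpa only [e] using h

end Objective

/-! ### Absolute continuity of nondegenerate Gaussian laws. -/

section Gaussian

theorem pi_absolutelyContinuous {μ ν : Measure ℝ} [SigmaFinite μ] [SigmaFinite ν] (h : μ ≪ ν) :
    ∀ n : ℕ, Measure.pi (fun _ : Fin n => μ) ≪ Measure.pi (fun _ : Fin n => ν)
  | 0 => by
    rw [Measure.pi_of_empty, Measure.pi_of_empty]
  | n + 1 => by
    have hμ := (measurePreserving_piFinSuccAbove (fun _ : Fin (n + 1) => μ) 0).symm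
    have hν := (measurePreserving_piFinSuccAbove (fun _ : Fin (n + 1) => ν) 0).symm
    rw [← hμ.map_eq, ← hν.map_eq]
    exact (h.prod (pi_absolutelyContinuous h n)).map hμ.measurable

theorem stdGaussian_absolutelyContinuous (p : ℕ) :
    stdGaussian (EuclideanSpace ℝ (Fin p)) ≪ volume := by
  rw [← map_pi_eq_stdGaussian, ← (PiLp.volume_preserving_toLp (Fin p)).map_eq]
  exact (pi_absolutelyContinuous (gaussianReal_absolutelyContinuous 0 one_ne_zero) p).map
    (PiLp.volume_preserving_toLp (Fin p)).measurable

open scoped MatrixOrder in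
-- The law is the image of the standard Gaussian under the square root of `S`, which is invertible
-- because `S` is.
theorem multivariateGaussian_absolutelyContinuous {p : ℕ} {S : Matrix (Fin p) (Fin p) ℝ}
    (hS : S.PosDef) : multivariateGaussian 0 S ≪ volume := by
  have hmul : CFC.sqrt S * CFC.sqrt S = S := CFC.sqrt_mul_sqrt_self S hS.posSemidef.nonneg
  have hu : IsUnit (CFC.sqrt S) := by
    have h := hS.isUnit
    rw [← hmul] at h
    exact (Commute.isUnit_mul_iff (Commute.refl _)).1 h |>.1
  set A := Matrix.toEuclideanCLM (𝕜 := ℝ) (CFC.sqrt S) with hA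
  have hdet : A.det ≠ 0 := by
    have h1 : IsUnit A := hu.map (Matrix.toEuclideanCLM (n := Fin p) (𝕜 := ℝ))
    have h2 := h1.map (ContinuousLinearMap.toLinearMapRingHom
      (R₁ := ℝ) (M₁ := EuclideanSpace ℝ (Fin p)))
    exact (LinearMap.isUnit_det _ h2).ne_zero
  have hq := Measure.ContinuousLinearMap.quasiMeasurePreserving
    (volume : Measure (EuclideanSpace ℝ (Fin p))) A hdet
  rw [multivariateGaussian]
  simp only [zero_add]
  exact ((stdGaussian_absolutelyContinuous p).map hq.measurable).trans hq.absolutelyContinuous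

end Gaussian

/-! ### Independence of paired sequences. -/

section Independence

variable {Ω : Type*} [MeasurableSpace Ω] {P : Measure Ω}

/-- Two independent sequences of independent variables form a sequence of independent pairs. -/
theorem iIndepFun_prodMk {ι α β : Type*} [mα : MeasurableSpace α] [mβ : MeasurableSpace β]
    {X : ι → Ω → α} {Y : ι → Ω → β} (hX : ∀ i, Measurable (X i)) (hY : ∀ i, Measurable (Y i))
    (hXi : iIndepFun X P) (hYi : iIndepFun Y P)
    (hXY : IndepFun (fun ω i => X i ω) (fun ω i => Y i ω) P) :
    iIndepFun (fun i ω => (X i ω, Y i ω)) P := by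
  rw [iIndepFun_iff_iIndep]
  -- It suffices to check factorization on the π-systems of preimages of measurable rectangles.
  refine iIndepSets.iIndep (fun i => ((hX i).prodMk (hY i)).comap_le)
    (fun i => {s | ∃ t, t ∈ Set.image2 (· ×ˢ ·) {s : Set α | MeasurableSet s}
      {t : Set β | MeasurableSet t} ∧ (fun ω => (X i ω, Y i ω)) ⁻¹' t = s})
    (fun i => isPiSystem_prod.comap _) (fun i => ?_) ?_
  · rw [← generateFrom_prod, MeasurableSpace.comap_generateFrom]
    rfl
  · rw [iIndepSets_iff]
    intro s f hf
    classical
    have hex : ∀ i, ∃ A : Set α, ∃ B : Set β, MeasurableSet A ∧ MeasurableSet B ∧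
        (i ∈ s → f i = X i ⁻¹' A ∩ Y i ⁻¹' B) := fun i => by
      by_cases hi : i ∈ s
      · obtain ⟨_, ⟨A, hA, B, hB, rfl⟩, h⟩ := hf i hi
        exact ⟨A, B, hA, hB, fun _ => h.symm⟩
      · exact ⟨∅, ∅, .empty, .empty, fun h => absurd h hi⟩
    choose A B hA hB hAB using hex
    have h1 : ⋂ i ∈ s, f i = (fun ω i => X i ω) ⁻¹' (⋂ i ∈ s, (fun x => x i) ⁻¹' A i) ∩
        (fun ω i => Y i ω) ⁻¹' (⋂ i ∈ s, (fun x => x i) ⁻¹' B i) := by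
      ext ω
      simp only [Set.mem_iInter, Set.mem_inter_iff, Set.mem_preimage]
      constructor
      · intro h
        refine ⟨fun i hi => ?_, fun i hi => ?_⟩
        · have := h i hi
          rw [hAB i hi] at this
          exact this.1
        · have := h i hi
          rw [hAB i hi] at this
          exact this.2
      · intro h i hi
        rw [hAB i hi]
        exact ⟨h.1 i hi, h.2 i hi⟩
    have hXY1 : ∀ i, IndepFun (X i) (Y i) P := fun i =>
      hXY.comp (measurable_pi_apply i) (measurable_pi_apply i)
    rw [h1, hXY.measure_inter_preimage_eq_mul _ _
      (Finset.measurableSet_biInter s fun i _ => measurable_pi_apply i (hA i))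
      (Finset.measurableSet_biInter s fun i _ => measurable_pi_apply i (hB i))]
    simp only [Set.preimage_iInter, ← Set.preimage_comp]
    have h2 := (iIndepFun_iff_measure_inter_preimage_eq_mul.1 hXi) s (sets := A) fun i _ => hA i
    have h3 := (iIndepFun_iff_measure_inter_preimage_eq_mul.1 hYi) s (sets := B) fun i _ => hB i
    refine (congrArg₂ (· * ·) h2 h3).trans ?_
    rw [← Finset.prod_mul_distrib]
    refine Finset.prod_congr rfl fun i hi => ?_
    rw [hAB i hi, (hXY1 i).measure_inter_preimage_eq_mul _ _ (hA i) (hB i)]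

end Independence

/-! ### Multivariate central limit theorem. -/

section CentralLimit

variable {Ω Ω' : Type*} [MeasurableSpace Ω] [MeasurableSpace Ω'] {P : Measure Ω}
  [IsProbabilityMeasure P] {P' : Measure Ω'} [IsProbabilityMeasure P'] {p : ℕ}

/-- Cramér–Wold: the characteristic function at `t` is that of the projection onto `t` at `1`, to
which the scalar theorem applies. -/
theorem tendsto_charFun_inv_sqrt_smul_sum {Z : ℕ → Ω → EuclideanSpace ℝ (Fin p)}
    (hindep : iIndepFun Z P) (hident : ∀ i, IdentDistrib (Z i) (Z 0) P P)
    (hL2 : MemLp (Z 0) 2 P) (hmean : ∫ ω, Z 0 ω ∂P = 0) (t : EuclideanSpace ℝ (Fin p)) :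
    Tendsto (fun n : ℕ => charFun (P.map fun ω => (√(n : ℝ))⁻¹ • ∑ i ∈ Finset.range n, Z i ω) t)
      atTop (𝓝 (charFun (gaussianReal 0 (∫ ω, (inner ℝ (Z 0 ω) t) ^ 2 ∂P).toNNReal) 1)) := by
  have hm : Measurable fun z : EuclideanSpace ℝ (Fin p) => inner ℝ z t := by fun_prop
  have hint : Integrable (Z 0) P := hL2.integrable (by norm_num)
  have hmean' : ∫ ω, inner ℝ (Z 0 ω) t ∂P = 0 := by
    have h := integral_inner (𝕜 := ℝ) hint t
    simp only [hmean, inner_zero_right] at h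
    simpa only [real_inner_comm] using h
  have hL2' : MemLp (fun ω => inner ℝ (Z 0 ω) t) 2 P := by
    have h := hL2.const_inner t (𝕜 := ℝ)
    simpa only [real_inner_comm] using h
  have hVar : Var[fun ω => inner ℝ (Z 0 ω) t; P] = ∫ ω, (inner ℝ (Z 0 ω) t) ^ 2 ∂P :=
    variance_of_integral_eq_zero hL2'.aemeasurable hmean'
  have hclt := tendstoInDistribution_inv_sqrt_mul_sum_sub
    (X := fun i ω => inner ℝ (Z i ω) t)
    (P' := gaussianReal 0 Var[fun ω => inner ℝ (Z 0 ω) t; P].toNNReal) (Y := id) .id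
    hL2' (hindep.comp (fun _ z => inner ℝ z t) fun _ => hm) fun i => (hident i).comp hm
  have h1 := ProbabilityMeasure.tendsto_iff_tendsto_charFun.1 hclt.tendsto 1
  simp only [ProbabilityMeasure.coe_mk, Measure.map_id, hVar] at h1
  refine h1.congr fun n => ?_
  have hn : AEMeasurable (fun ω => (√(n : ℝ))⁻¹ • ∑ i ∈ Finset.range n, Z i ω) P :=
    AEMeasurable.fun_const_smul
      (Finset.aemeasurable_fun_sum _ fun i _ => (hident i).aemeasurable_fst) _
  rw [charFun_apply, charFun_apply, integral_map (hclt.forall_aemeasurable n) (by fun_prop),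
    integral_map hn (by fun_prop)]
  refine integral_congr_ae (.of_forall fun ω => ?_)
  simp [hmean', real_inner_smul_left, sum_inner]

/-- The multivariate central limit theorem for centered vectors. -/
theorem tendstoInDistribution_inv_sqrt_smul_sum {Z : ℕ → Ω → EuclideanSpace ℝ (Fin p)}
    (hindep : iIndepFun Z P) (hident : ∀ i, IdentDistrib (Z i) (Z 0) P P)
    (hL2 : MemLp (Z 0) 2 P) (hmean : ∫ ω, Z 0 ω ∂P = 0) {S : Matrix (Fin p) (Fin p) ℝ}
    (hS : S.PosSemidef)
    (hvar : ∀ t : EuclideanSpace ℝ (Fin p),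
      ∫ ω, (inner ℝ (Z 0 ω) t) ^ 2 ∂P = t ⬝ᵥ S.mulVec t)
    {W : Ω' → EuclideanSpace ℝ (Fin p)} (hW : HasLaw W (multivariateGaussian 0 S) P') :
    TendstoInDistribution (fun (n : ℕ) ω => (√(n : ℝ))⁻¹ • ∑ i ∈ Finset.range n, Z i ω) atTop W
      (fun _ => P) P' where
  forall_aemeasurable n :=
    AEMeasurable.fun_const_smul
      (Finset.aemeasurable_fun_sum _ fun i _ => (hident i).aemeasurable_fst) _
  aemeasurable_limit := hW.aemeasurable
  tendsto := by
    refine ProbabilityMeasure.tendsto_iff_tendsto_charFun.2 fun t => ?_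
    have hlim : charFun (P'.map W) t =
        charFun (gaussianReal 0 (∫ ω, (inner ℝ (Z 0 ω) t) ^ 2 ∂P).toNNReal) 1 := by
      have h0 : 0 ≤ t ⬝ᵥ S.mulVec t := by
        rw [← hvar t]; positivity
      rw [hW.map_eq, charFun_multivariateGaussian hS, charFun_gaussianReal, hvar,
        Real.coe_toNNReal _ h0]
      simp
    simp only [ProbabilityMeasure.coe_mk]
    rw [hlim]
    exact tendsto_charFun_inv_sqrt_smul_sum hindep hident hL2 hmean t

end CentralLimit

/-! ### Portmanteau with exceptional events. -/

section Portmanteau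

/-- `P (B n)` is squeezed between the probabilities of the interior and the closure of `A`, up to `P
(H n)ᶜ`. Hence neither `A` nor `B n` has to be measurable. -/
theorem tendsto_measure_of_ae_iff {Ω Ω' E : Type*} [MeasurableSpace Ω] [MeasurableSpace Ω']
    {P : Measure Ω} [IsProbabilityMeasure P] {P' : Measure Ω'} [IsProbabilityMeasure P']
    [PseudoEMetricSpace E] [MeasurableSpace E] [BorelSpace E] {Y : ℕ → Ω → E} {Z : Ω' → E}
    (hY : TendstoInDistribution Y atTop Z (fun _ => P) P') {A : Set E}
    (hA : P'.map Z (frontier A) = 0) {B H : ℕ → Set Ω}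
    (hH : Tendsto (fun n => P (H n)ᶜ) atTop (𝓝 0))
    (hB : ∀ n, ∀ᵐ ω ∂P, ω ∈ H n → (ω ∈ B n ↔ Y n ω ∈ A)) :
    Tendsto (fun n => P (B n)) atTop (𝓝 (P' {ω | Z ω ∈ A})) := by
  have hZm := hY.aemeasurable_limit
  have hYm := hY.forall_aemeasurable
  have hZA : P' {ω | Z ω ∈ A} = P'.map Z A :=
    (Measure.map_apply₀ hZm (nullMeasurableSet_of_null_frontier hA)).symm
  have hint : P'.map Z (interior A) = P'.map Z A :=
    measure_congr (interior_ae_eq_of_null_frontier hA)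
  have hcl : P'.map Z (closure A) = P'.map Z A :=
    measure_congr (closure_ae_eq_of_null_frontier hA)
  have h1 : Tendsto (fun n => P.map (Y n) (interior A)) atTop (𝓝 (P'.map Z A)) := by
    rw [← hint]
    exact ProbabilityMeasure.tendsto_measure_of_null_frontier_of_tendsto' hY.tendsto
      (measure_mono_null frontier_interior_subset hA)
  have h2 : Tendsto (fun n => P.map (Y n) (closure A)) atTop (𝓝 (P'.map Z A)) := by
    rw [← hcl]
    exact ProbabilityMeasure.tendsto_measure_of_null_frontier_of_tendsto' hY.tendsto
      (measure_mono_null frontier_closure_subset hA)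
  rw [hZA]
  have h3 : Tendsto (fun n => P.map (Y n) (interior A) - P (H n)ᶜ) atTop
      (𝓝 (P'.map Z A)) := by
    simpa using ENNReal.Tendsto.sub h1 hH (Or.inr ENNReal.zero_ne_top)
  have h4 : Tendsto (fun n => P.map (Y n) (closure A) + P (H n)ᶜ) atTop
      (𝓝 (P'.map Z A)) := by
    simpa using h2.add hH
  refine tendsto_of_tendsto_of_tendsto_of_le_of_le h3 h4 (fun n => ?_) fun n => ?_
  · simp only
    rw [tsub_le_iff_right, Measure.map_apply_of_aemeasurable (hYm n) measurableSet_interior]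
    refine (measure_mono_ae ?_).trans (measure_union_le _ _)
    filter_upwards [hB n] with ω hω h
    by_cases hm : ω ∈ H n
    · exact Or.inl ((hω hm).2 (interior_subset h))
    · exact Or.inr hm
  · simp only
    rw [Measure.map_apply_of_aemeasurable (hYm n) measurableSet_closure]
    refine (measure_mono_ae ?_).trans (measure_union_le _ _)
    filter_upwards [hB n] with ω hω h
    by_cases hm : ω ∈ H n
    · exact Or.inl (subset_closure ((hω hm).1 h))
    · exact Or.inr hm

/-- If `D n` converges in distribution to a constant, it converges in measure. -/
theorem tendstoInMeasure_of_tendstoInDistribution_zero {Ω Ω' : Type*} [MeasurableSpace Ω]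
    [MeasurableSpace Ω'] {P : Measure Ω} [IsProbabilityMeasure P] {P' : Measure Ω'}
    [IsProbabilityMeasure P'] {D : ℕ → Ω → ℝ}
    (hD : TendstoInDistribution D atTop (fun _ => (0 : ℝ)) (fun _ => P) P') :
    TendstoInMeasure P D atTop (fun _ => 0) := by
  rw [tendstoInMeasure_iff_norm]
  intro ε hε
  have hcl : IsClosed {x : ℝ | ε ≤ ‖x‖} := isClosed_le continuous_const continuous_norm
  have hfr : P'.map (fun _ => (0 : ℝ)) (frontier {x : ℝ | ε ≤ ‖x‖}) = 0 := by
    rw [Measure.map_const, measure_univ, one_smul, Measure.dirac_apply' _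
      isClosed_frontier.measurableSet, Set.indicator_of_notMem]
    intro h
    have := hcl.frontier_subset h
    simp only [Set.mem_ofPred_eq, norm_zero] at this
    linarith
  have h := tendsto_measure_of_ae_iff hD hfr (B := fun n => {ω | ε ≤ ‖D n ω - 0‖})
    (H := fun _ => Set.univ) (by simp) (fun n => .of_forall fun ω _ => by simp)
  simpa [hε.not_ge] using h

end Portmanteau

/-! ### Second moments of `X` and of the products `ε X`. -/

section Moments

variable {Ω : Type*} [MeasurableSpace Ω] {P : Measure Ω} {p : ℕ}

theorem continuous_rankOne_self : Continuous fun x : EuclideanSpace ℝ (Fin p) =>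
    InnerProductSpace.rankOne ℝ x x := by
  change Continuous fun x : EuclideanSpace ℝ (Fin p) =>
    ContinuousLinearMap.smulRightL ℝ (EuclideanSpace ℝ (Fin p)) (EuclideanSpace ℝ (Fin p))
      (innerSL ℝ x) x
  fun_prop

theorem integrable_rankOne_self {X : Ω → EuclideanSpace ℝ (Fin p)} (hX : MemLp X 2 P) :
    Integrable (fun ω => InnerProductSpace.rankOne ℝ (X ω) (X ω)) P := by
  refine (hX.integrable_norm_pow (by norm_num)).mono'
    (continuous_rankOne_self.comp_aestronglyMeasurable hX.1) (.of_forall fun ω => ?_)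
  rw [InnerProductSpace.norm_rankOne]
  exact (sq ‖X ω‖).ge

theorem inner_integral_apply {A : Ω → EuclideanSpace ℝ (Fin p) →L[ℝ] EuclideanSpace ℝ (Fin p)}
    (hA : Integrable A P) (u w : EuclideanSpace ℝ (Fin p)) :
    inner ℝ w ((∫ ω, A ω ∂P) u) = ∫ ω, inner ℝ w (A ω u) ∂P := by
  have h := (innerSL ℝ w ∘L ContinuousLinearMap.apply ℝ (EuclideanSpace ℝ (Fin p)) u)
    |>.integral_comp_comm hA
  exact h.symm

/-- The second moment operator of a centered vector is given by its covariance matrix. -/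
theorem integral_rankOne_self [IsProbabilityMeasure P]
    {X : Ω → EuclideanSpace ℝ (Fin p)} (hX : MemLp X 2 P)
    (hmean : ∫ ω, X ω ∂P = 0) {C : Matrix (Fin p) (Fin p) ℝ}
    (hcov : ∀ j k, cov[fun ω => X ω j, fun ω => X ω k; P] = C j k) :
    ∫ ω, InnerProductSpace.rankOne ℝ (X ω) (X ω) ∂P = Matrix.toEuclideanCLM (𝕜 := ℝ) C := by
  have hc : ∀ j, MemLp (fun ω => X ω j) 2 P := fun j =>
    hX.continuousLinearMap_comp (EuclideanSpace.proj (𝕜 := ℝ) j)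
  have hm : ∀ j, ∫ ω, X ω j ∂P = 0 := fun j => by
    have h := (EuclideanSpace.proj (𝕜 := ℝ) j).integral_comp_comm (hX.integrable (by norm_num))
    rw [hmean, map_zero] at h
    exact h
  have hmul : ∀ j k, ∫ ω, X ω j * X ω k ∂P = C j k := fun j k => by
    rw [← hcov j k, covariance_eq_sub (hc j) (hc k), hm j, zero_mul, sub_zero]
    rfl
  refine ContinuousLinearMap.coe_injective ((EuclideanSpace.basisFun (Fin p) ℝ).toBasis.ext
    fun k => ext_inner_left ℝ fun w => ?_)
  have hsum : ∀ ω, inner ℝ w (InnerProductSpace.rankOne ℝ (X ω) (X ω)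
      (EuclideanSpace.basisFun (Fin p) ℝ k)) = ∑ j, w j * (X ω j * X ω k) := fun ω => by
    simp [PiLp.inner_apply, mul_comm]
  simp only [OrthonormalBasis.coe_toBasis, ContinuousLinearMap.coe_coe]
  rw [inner_integral_apply (integrable_rankOne_self hX)]
  simp only [hsum]
  have hi : ∀ j ∈ Finset.univ, Integrable (fun ω => w j * (X ω j * X ω k)) P :=
    fun j _ => ((hc j).integrable_mul (hc k)).const_mul _
  rw [integral_finsetSum _ hi]
  simp [integral_const_mul, hmul, Matrix.inner_toEuclideanCLM, dotProduct]

/-- The squared norm is a product of independent integrable variables, so no fourth moments are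
needed. -/
theorem memLp_smul_of_indepFun {e : Ω → ℝ} {x : Ω → EuclideanSpace ℝ (Fin p)}
    (hx : MemLp x 2 P) (he : MemLp e 2 P) (hxe : IndepFun x e P) :
    MemLp (fun ω => e ω • x ω) 2 P := by
  have hm : AEStronglyMeasurable (fun ω => e ω • x ω) P := he.1.smul hx.1
  rw [memLp_two_iff_integrable_sq_norm hm]
  have hind : IndepFun (fun ω => ‖x ω‖ ^ 2) (fun ω => ‖e ω‖ ^ 2) P :=
    hxe.comp (φ := fun z => ‖z‖ ^ 2) (ψ := fun z => ‖z‖ ^ 2) (by fun_prop) (by fun_prop)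
  have h := hind.integrable_mul
    (hx.integrable_norm_pow (by norm_num)) (he.integrable_norm_pow (by norm_num))
  refine h.congr (.of_forall fun ω => ?_)
  simp [norm_smul, mul_pow, mul_comm]

theorem integral_inner_smul_sq_of_indepFun {e : Ω → ℝ} {x : Ω → EuclideanSpace ℝ (Fin p)}
    (hx : MemLp x 2 P) (he : MemLp e 2 P) (hxe : IndepFun x e P) (t : EuclideanSpace ℝ (Fin p)) :
    ∫ ω, inner ℝ (e ω • x ω) t ^ 2 ∂P = (∫ ω, e ω ^ 2 ∂P) * ∫ ω, inner ℝ (x ω) t ^ 2 ∂P := by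
  have hind : IndepFun (fun ω => e ω ^ 2) (fun ω => inner ℝ (x ω) t ^ 2) P :=
    hxe.symm.comp (φ := fun z => z ^ 2) (ψ := fun z => inner ℝ z t ^ 2) (by fun_prop)
      (by fun_prop)
  have hc : Continuous fun z : EuclideanSpace ℝ (Fin p) => inner ℝ z t ^ 2 := by fun_prop
  rw [← hind.integral_fun_mul_eq_mul_integral (he.1.pow 2) (hc.comp_aestronglyMeasurable hx.1)]
  simp only [real_inner_smul_left, mul_pow]

theorem integral_smul_eq_zero_of_indepFun [IsProbabilityMeasure P]
    {e : Ω → ℝ} {x : Ω → EuclideanSpace ℝ (Fin p)}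
    (hx : MemLp x 2 P) (he : MemLp e 2 P) (hmean : ∫ ω, e ω ∂P = 0) (hxe : IndepFun x e P) :
    ∫ ω, e ω • x ω ∂P = 0 := by
  have hint := (memLp_smul_of_indepFun hx he hxe).integrable (by norm_num)
  refine ext_inner_left ℝ fun t => ?_
  have hind : IndepFun e (fun ω => inner ℝ t (x ω)) P :=
    hxe.symm.comp (φ := id) (ψ := fun z => inner ℝ t z) measurable_id (by fun_prop)
  have h := hind.integral_fun_mul_eq_mul_integral he.1
    (hx.const_inner t (𝕜 := ℝ)).1
  rw [← integral_inner hint, inner_zero_right]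
  simp only [real_inner_smul_right]
  rw [h, hmean, zero_mul]

end Moments

/-! ### Limit theorems for the linear model. -/

section Model

variable {Ω : Type*} [MeasurableSpace Ω] {P : Measure Ω} [IsProbabilityMeasure P] {p : ℕ}
  {X : ℕ → Ω → EuclideanSpace ℝ (Fin p)} {ε : ℕ → Ω → ℝ}

theorem ae_tendsto_empiricalCov (hX_indep : iIndepFun X P)
    (hX_ident : ∀ i, IdentDistrib (X i) (X 0) P P) (hX_L2 : MemLp (X 0) 2 P)
    (hX_mean : ∫ ω, X 0 ω ∂P = 0) {C : Matrix (Fin p) (Fin p) ℝ}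
    (hX_cov : ∀ j k, cov[fun ω => X 0 ω j, fun ω => X 0 ω k; P] = C j k) :
    ∀ᵐ ω ∂P, Tendsto (fun n => empiricalCov (fun i => X i ω) n) atTop
      (𝓝 (Matrix.toEuclideanCLM (𝕜 := ℝ) C)) := by
  have hm := (continuous_rankOne_self (p := p)).measurable
  have h := strong_law_ae (μ := P)
    (fun i ω => InnerProductSpace.rankOne ℝ (X i ω) (X i ω)) (integrable_rankOne_self hX_L2)
    (fun i j hij => (hX_indep.indepFun hij).comp hm hm) fun i => (hX_ident i).comp hm
  rwa [integral_rankOne_self hX_L2 hX_mean hX_cov] at h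

theorem integral_inner_sq_eq (hX_L2 : MemLp (X 0) 2 P)
    (hX_mean : ∫ ω, X 0 ω ∂P = 0) {C : Matrix (Fin p) (Fin p) ℝ}
    (hX_cov : ∀ j k, cov[fun ω => X 0 ω j, fun ω => X 0 ω k; P] = C j k)
    (t : EuclideanSpace ℝ (Fin p)) :
    ∫ ω, inner ℝ (X 0 ω) t ^ 2 ∂P = t ⬝ᵥ C.mulVec t := by
  rw [← Matrix.inner_toEuclideanCLM, ← integral_rankOne_self hX_L2 hX_mean hX_cov,
    inner_integral_apply (integrable_rankOne_self hX_L2)]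
  refine integral_congr_ae (.of_forall fun ω => ?_)
  simp [real_inner_smul_right, real_inner_comm t (X 0 ω), sq]

/-- The score converges in distribution, and the averaged score almost surely to zero. -/
theorem tendstoInDistribution_score {Ω' : Type*} [MeasurableSpace Ω'] {P' : Measure Ω'}
    [IsProbabilityMeasure P']
    (hX_meas : ∀ i, Measurable (X i)) (hε_meas : ∀ i, Measurable (ε i))
    (hX_indep : iIndepFun X P) (hX_ident : ∀ i, IdentDistrib (X i) (X 0) P P)
    (hX_L2 : MemLp (X 0) 2 P) (hX_mean : ∫ ω, X 0 ω ∂P = 0) {C : Matrix (Fin p) (Fin p) ℝ}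
    (hC : C.PosSemidef)
    (hX_cov : ∀ j k, cov[fun ω => X 0 ω j, fun ω => X 0 ω k; P] = C j k)
    (hε_indep : iIndepFun ε P) (hε_ident : ∀ i, IdentDistrib (ε i) (ε 0) P P)
    (hε_L2 : MemLp (ε 0) 2 P) (hε_mean : ∫ ω, ε 0 ω ∂P = 0)
    {σ : ℝ} (hε_var : Var[ε 0; P] = σ ^ 2)
    (hXε : IndepFun (fun ω i => X i ω) (fun ω i => ε i ω) P)
    {W : Ω' → EuclideanSpace ℝ (Fin p)}
    (hW : HasLaw W (multivariateGaussian 0 (σ ^ 2 • C)) P') :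
    TendstoInDistribution (fun n ω => score (fun i => X i ω) (fun i => ε i ω) n) atTop W
      (fun _ => P) P' ∧
    ∀ᵐ ω ∂P, Tendsto (fun n : ℕ => (√(n : ℝ))⁻¹ • score (fun i => X i ω) (fun i => ε i ω) n)
      atTop (𝓝 0) := by
  have hpair : ∀ i, IndepFun (X i) (ε i) P := fun i =>
    hXε.comp (measurable_pi_apply i) (measurable_pi_apply i)
  have hφ : Measurable fun z : EuclideanSpace ℝ (Fin p) × ℝ => z.2 • z.1 := by fun_prop
  have hZ_indep : iIndepFun (fun i ω => ε i ω • X i ω) P :=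
    (iIndepFun_prodMk hX_meas hε_meas hX_indep hε_indep hXε).comp (fun _ z => z.2 • z.1)
      fun _ => hφ
  have hZ_ident : ∀ i, IdentDistrib (fun ω => ε i ω • X i ω) (fun ω => ε 0 ω • X 0 ω) P P :=
    fun i => ((hX_ident i).prodMk (hε_ident i) (hpair i) (hpair 0)).comp hφ
  have hZ_L2 := memLp_smul_of_indepFun hX_L2 hε_L2 (hpair 0)
  have hZ_mean := integral_smul_eq_zero_of_indepFun hX_L2 hε_L2 hε_mean (hpair 0)
  constructor
  · refine tendstoInDistribution_inv_sqrt_smul_sum hZ_indep hZ_ident hZ_L2 hZ_mean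
      (hC.smul (sq_nonneg σ)) (fun t => ?_) hW
    rw [integral_inner_smul_sq_of_indepFun hX_L2 hε_L2 (hpair 0),
      integral_inner_sq_eq hX_L2 hX_mean hX_cov,
      ← variance_of_integral_eq_zero hε_L2.aemeasurable hε_mean, hε_var,
      Matrix.smul_mulVec, dotProduct_smul, smul_eq_mul]
  -- The score divided by `√n` is the sample mean of the vectors `ε i • X i`.
  · have h := strong_law_ae (μ := P) (fun i ω => ε i ω • X i ω)
      (hZ_L2.integrable (by norm_num)) (fun i j hij => hZ_indep.indepFun hij) hZ_ident
    rw [hZ_mean] at h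
    filter_upwards [h] with ω hω
    refine hω.congr fun n => ?_
    rw [score, smul_smul, ← mul_inv, Real.mul_self_sqrt n.cast_nonneg]

end Model

/-! ### Reduction to the limiting problem on a good event. -/

section Perturbation

theorem exists_le_inner_of_pos {E : Type*} [NormedAddCommGroup E] [InnerProductSpace ℝ E]
    [FiniteDimensional ℝ E] {T : E →L[ℝ] E} (hT : ∀ u, u ≠ 0 → 0 < inner ℝ (T u) u) :
    ∃ c > 0, ∀ u, c * ‖u‖ ^ 2 ≤ inner ℝ (T u) u := by
  -- The sphere is empty exactly in the zero space; otherwise the constant is the minimum of the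
  -- form on it.
  rcases (Metric.sphere (0 : E) 1).eq_empty_or_nonempty with hs | hs
  · refine ⟨1, one_pos, fun u => ?_⟩
    have hu : u = 0 := by
      by_contra hu
      have : ‖u‖⁻¹ • u ∈ Metric.sphere (0 : E) 1 := by
        simp [norm_smul, inv_mul_cancel₀ (norm_ne_zero_iff.2 hu)]
      rw [hs] at this
      exact this
    simp [hu]
  · obtain ⟨x, hx, hmin⟩ := (isCompact_sphere (0 : E) 1).exists_isMinOn hs
      (f := fun u => inner ℝ (T u) u) (by fun_prop)
    have hx1 : ‖x‖ = 1 := by simpa using hx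
    refine ⟨inner ℝ (T x) x, hT x (norm_ne_zero_iff.1 (by rw [hx1]; exact one_ne_zero)),
      fun u => ?_⟩
    rcases eq_or_ne u 0 with rfl | hu
    · simp
    have hu' := norm_ne_zero_iff.2 hu
    have h := isMinOn_iff.1 hmin (‖u‖⁻¹ • u) (by simp [norm_smul, inv_mul_cancel₀ hu'])
    rw [map_smul, real_inner_smul_left, real_inner_smul_right] at h
    calc inner ℝ (T x) x * ‖u‖ ^ 2 ≤ (‖u‖⁻¹ * (‖u‖⁻¹ * inner ℝ (T u) u)) * ‖u‖ ^ 2 := by gcongr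
      _ = inner ℝ (T u) u := by field_simp

theorem le_inner_of_norm_sub_le {E : Type*} [NormedAddCommGroup E] [InnerProductSpace ℝ E]
    {S T : E →L[ℝ] E} {c : ℝ} (hT : ∀ u, 2 * c * ‖u‖ ^ 2 ≤ inner ℝ (T u) u)
    (hS : ‖S - T‖ ≤ c) (u : E) : c * ‖u‖ ^ 2 ≤ inner ℝ (S u) u := by
  have h1 := (abs_le.1 (abs_real_inner_le_norm ((S - T) u) u)).1
  have h2 := mul_le_mul_of_nonneg_right
    (((S - T).le_opNorm u).trans (mul_le_mul_of_nonneg_right hS (norm_nonneg u))) (norm_nonneg u)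
  have h3 := hT u
  rw [sub_apply, inner_sub_left, ← sub_apply] at h1
  linarith

variable {p : ℕ} {ι : Type*} [Fintype ι] [Nonempty ι]

/-- When the empirical covariance is close to `T` and the score is not too large, every minimizer
of the objective solves, after rescaling, the limiting problem with a perturbed linear term. -/
theorem mem_solutionSet_iff_of_isMinOn_objective {v : ι → EuclideanSpace ℝ (Fin p)}
    {g : EuclideanSpace ℝ (Fin p) → ℝ} (hg : ContDiff ℝ 1 g)
    {β₀ s : EuclideanSpace ℝ (Fin p)} (hs : IsSubgradient (penalty v g) β₀ s) {δ : ℝ}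
    (hδ : ∀ y, ‖y‖ < δ → polyMax v (β₀ + y) = polyMax v β₀ + polyMax (activeFamily v β₀) y)
    {T : EuclideanSpace ℝ (Fin p) →L[ℝ] EuclideanSpace ℝ (Fin p)} {c : ℝ} (hc : 0 < c)
    (hT : ∀ u, 2 * c * ‖u‖ ^ 2 ≤ inner ℝ (T u) u)
    {x : ℕ → EuclideanSpace ℝ (Fin p)} {e : ℕ → ℝ} {n : ℕ} (hn : 0 < n)
    (hx : ‖empiricalCov x n - T‖ ≤ c)
    (he : 2 / c * (‖(√(n : ℝ))⁻¹ • score x e n‖ + (√(n : ℝ))⁻¹ * ‖s‖) < δ)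
    {b : EuclideanSpace ℝ (Fin p)}
    (hb : (∃ b, IsMinOn (objective (penalty v g) β₀ x e n) Set.univ b) →
      IsMinOn (objective (penalty v g) β₀ x e n) Set.univ b) :
    ‖√(n : ℝ) • (b - β₀)‖ ≤ 2 / c * (‖score x e n‖ + ‖s‖) ∧
    ‖b - β₀‖ ≤ 2 / c * (‖(√(n : ℝ))⁻¹ • score x e n‖ + (√(n : ℝ))⁻¹ * ‖s‖) ∧
    ∀ K, score x e n + (T - empiricalCov x n) (√(n : ℝ) • (b - β₀)) - gradient g b ∈
      solutionSet (activeFamily v β₀) T K ↔ √(n : ℝ) • (b - β₀) ∈ K := by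
  have hn' : 0 < √(n : ℝ) := Real.sqrt_pos.2 (by exact_mod_cast hn)
  have hlow := le_inner_of_norm_sub_le hT hx
  have hmin := hb (exists_isMinOn_objective (continuous_penalty v hg.continuous) hs x e hn hc hlow)
  have h1 := norm_le_of_isMinOn_objective hs x e hn hc hlow hmin
  have h2 : ‖b - β₀‖ ≤ 2 / c * (‖(√(n : ℝ))⁻¹ • score x e n‖ + (√(n : ℝ))⁻¹ * ‖s‖) := by
    have h := mul_le_mul_of_nonneg_left h1 (inv_nonneg.2 hn'.le)
    rw [norm_smul, Real.norm_of_nonneg hn'.le, ← mul_assoc, inv_mul_cancel₀ hn'.ne', one_mul] at h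
    rw [norm_smul, Real.norm_of_nonneg (inv_nonneg.2 hn'.le)]
    linarith
  refine ⟨h1, h2, fun K => mem_solutionSet_iff (fun u hu => ?_) ?_⟩
  · have := norm_pos_iff.2 hu
    exact lt_of_lt_of_le (by positivity) (hT u)
  · have h := isSubgradient_of_isMinOn_objective v hg hδ x e hn hmin (h2.trans_lt he)
    convert h using 1
    rw [sub_apply]
    abel

end Perturbation

/-! ### Measurability of the empirical quantities. -/

section Measurability

variable {Ω : Type*} [MeasurableSpace Ω] {p : ℕ} {X : ℕ → Ω → EuclideanSpace ℝ (Fin p)}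
  {ε : ℕ → Ω → ℝ}

theorem measurable_empiricalCov (hX : ∀ i, Measurable (X i)) (n : ℕ) :
    Measurable fun ω => empiricalCov (fun i => X i ω) n := by
  have : ProperSpace (EuclideanSpace ℝ (Fin p) →L[ℝ] EuclideanSpace ℝ (Fin p)) :=
    FiniteDimensional.proper ℝ _
  unfold empiricalCov
  exact (Finset.measurable_fun_sum _ fun i _ =>
    continuous_rankOne_self.measurable.comp (hX i)).fun_const_smul ((n : ℝ)⁻¹)

theorem measurable_score (hX : ∀ i, Measurable (X i)) (hε : ∀ i, Measurable (ε i)) (n : ℕ) :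
    Measurable fun ω => score (fun i => X i ω) (fun i => ε i ω) n := by
  unfold score
  exact (Finset.measurable_fun_sum _ fun i _ => (hε i).smul (hX i)).fun_const_smul ((√(n : ℝ))⁻¹)

theorem aemeasurable_clm_apply {P : Measure Ω}
    {A : Ω → EuclideanSpace ℝ (Fin p) →L[ℝ] EuclideanSpace ℝ (Fin p)} (hA : Measurable A)
    {u : Ω → EuclideanSpace ℝ (Fin p)} (hu : AEMeasurable u P) :
    AEMeasurable (fun ω => A ω (u ω)) P := by
  have : ProperSpace (EuclideanSpace ℝ (Fin p) →L[ℝ] EuclideanSpace ℝ (Fin p)) :=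
    FiniteDimensional.proper ℝ _
  have hc : Continuous fun z : (EuclideanSpace ℝ (Fin p) →L[ℝ] EuclideanSpace ℝ (Fin p)) ×
      EuclideanSpace ℝ (Fin p) => z.1 z.2 := by fun_prop
  exact hc.measurable.comp_aemeasurable (hA.aemeasurable.prodMk hu)

end Measurability

/-! ### Assembly of the limit argument. -/

theorem tendstoInMeasure_zero_of_norm_le {Ω E : Type*} [MeasurableSpace Ω]
    [SeminormedAddCommGroup E] {P : Measure Ω} {Q : ℕ → Ω → E} {D : ℕ → Ω → ℝ}
    (hD : TendstoInMeasure P D atTop fun _ => 0) (hQ : ∀ n, ∀ᵐ ω ∂P, ‖Q n ω‖ ≤ D n ω) :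
    TendstoInMeasure P Q atTop fun _ => 0 := by
  rw [tendstoInMeasure_iff_norm] at hD ⊢
  intro r hr
  refine tendsto_of_tendsto_of_tendsto_of_le_of_le tendsto_const_nhds (hD r hr)
    (fun _ => zero_le) fun n => measure_mono_ae ?_
  filter_upwards [hQ n] with ω hω h
  have h' : r ≤ ‖Q n ω - 0‖ := h
  rw [sub_zero] at h'
  change r ≤ ‖D n ω - 0‖
  rw [sub_zero]
  exact h'.trans (hω.trans (le_abs_self _))

/-- The rescaled minimizers lie in a convex set with asymptotically the same probability as the
minimizer of the limiting objective. -/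
theorem tendsto_measure_minimizer_mem {p : ℕ} {ι : Type*} [Fintype ι] [Nonempty ι]
    {Ω : Type*} [MeasurableSpace Ω] {P : Measure Ω} [IsProbabilityMeasure P]
    {Ω' : Type*} [MeasurableSpace Ω'] {P' : Measure Ω'} [IsProbabilityMeasure P']
    {v : ι → EuclideanSpace ℝ (Fin p)} {g : EuclideanSpace ℝ (Fin p) → ℝ}
    (hg_convex : ConvexOn ℝ Set.univ g) (hg_smooth : ContDiff ℝ 1 g)
    {β₀ : EuclideanSpace ℝ (Fin p)} {C : Matrix (Fin p) (Fin p) ℝ} (hC : C.PosDef)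
    {τ : ℝ} (hτ : 0 < τ)
    {X : ℕ → Ω → EuclideanSpace ℝ (Fin p)} {ε : ℕ → Ω → ℝ}
    (hX_meas : ∀ i, Measurable (X i)) (hε_meas : ∀ i, Measurable (ε i))
    {W : Ω' → EuclideanSpace ℝ (Fin p)} (hW : HasLaw W (multivariateGaussian 0 (τ • C)) P')
    (hcov : ∀ᵐ ω ∂P, Tendsto (fun n => empiricalCov (fun i => X i ω) n) atTop
      (𝓝 (Matrix.toEuclideanCLM (𝕜 := ℝ) C)))
    (hscore : TendstoInDistribution (fun n ω => score (fun i => X i ω) (fun i => ε i ω) n) atTop W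
      (fun _ => P) P')
    (hscore_zero : ∀ᵐ ω ∂P, Tendsto (fun n : ℕ =>
      (√(n : ℝ))⁻¹ • score (fun i => X i ω) (fun i => ε i ω) n) atTop (𝓝 0))
    {βhat : ℕ → Ω → EuclideanSpace ℝ (Fin p)} (hβ_meas : ∀ n, AEMeasurable (βhat n) P)
    (hβ : ∀ n, ∀ᵐ ω ∂P,
      (∃ b, IsMinOn (objective (penalty v g) β₀
        (fun i => X i ω) (fun i => ε i ω) n) Set.univ b) →
      IsMinOn (objective (penalty v g) β₀
        (fun i => X i ω) (fun i => ε i ω) n) Set.univ (βhat n ω))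
    {uhat : Ω' → EuclideanSpace ℝ (Fin p)}
    (huhat : ∀ᵐ ω ∂P', IsMinOn
      (limitObjective (penalty v g) β₀ C (W ω)) Set.univ (uhat ω))
    {K : Set (EuclideanSpace ℝ (Fin p))} (hK : Convex ℝ K) :
    Tendsto (fun n : ℕ => P {ω | √(n : ℝ) • (βhat n ω - β₀) ∈ K}) atTop
      (𝓝 (P' {ω | uhat ω ∈ K})) := by
  set T := Matrix.toEuclideanCLM (𝕜 := ℝ) C with hTdef
  have hTpos : ∀ u, u ≠ 0 → 0 < inner ℝ (T u) u := fun u hu => by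
    rw [real_inner_comm, hTdef, Matrix.inner_toEuclideanCLM]
    exact hC.dotProduct_mulVec_pos (x := u) fun h => hu (by ext i; exact congrFun h i)
  obtain ⟨c, hc, hT⟩ : ∃ c > 0, ∀ u, 2 * c * ‖u‖ ^ 2 ≤ inner ℝ (T u) u := by
    obtain ⟨c, hc, h⟩ := exists_le_inner_of_pos hTpos
    exact ⟨c / 2, half_pos hc, fun u => by rw [mul_div_cancel₀ c two_ne_zero]; exact h u⟩
  obtain ⟨s, hs⟩ := exists_isSubgradient_penalty v hg_convex hg_smooth β₀
  obtain ⟨δ, hδ0, hδ⟩ := polyMax_add_eq v β₀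
  set S : ℕ → Ω → EuclideanSpace ℝ (Fin p) →L[ℝ] EuclideanSpace ℝ (Fin p) :=
    fun n ω => empiricalCov (fun i => X i ω) n with hSdef
  set Z : ℕ → Ω → EuclideanSpace ℝ (Fin p) :=
    fun n ω => score (fun i => X i ω) (fun i => ε i ω) n with hZdef
  have : ProperSpace (EuclideanSpace ℝ (Fin p) →L[ℝ] EuclideanSpace ℝ (Fin p)) :=
    FiniteDimensional.proper ℝ _
  have hSm : ∀ n, Measurable (S n) := measurable_empiricalCov hX_meas
  have hZm : ∀ n, Measurable (Z n) := measurable_score hX_meas hε_meas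
  -- The a priori bound on `‖βhat n - β₀‖`. Its almost sure convergence to zero gives strong
  -- consistency and puts `ω` in `H n` eventually.
  set r : ℕ → Ω → ℝ := fun n ω => 2 / c * (‖(√(n : ℝ))⁻¹ • Z n ω‖ + (√(n : ℝ))⁻¹ * ‖s‖) with hrdef
  have hrm : ∀ n, Measurable (r n) := fun n =>
    (((hZm n).fun_const_smul _).norm.add_const _).const_mul _
  set U : ℕ → Ω → EuclideanSpace ℝ (Fin p) := fun n ω => √(n : ℝ) • (βhat n ω - β₀) with hUdef
  set H : ℕ → Set Ω := fun n => {ω | 0 < n ∧ ‖S n ω - T‖ ≤ c ∧ r n ω < δ} with hHdef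
  have hHm : ∀ n, MeasurableSet (H n) := fun n =>
    (MeasurableSet.const _).inter ((measurableSet_le ((hSm n).sub_const T).norm
      measurable_const).inter (measurableSet_lt (hrm n) measurable_const))
  have hr0 : ∀ᵐ ω ∂P, Tendsto (fun n => r n ω) atTop (𝓝 0) := by
    filter_upwards [hscore_zero] with ω hω
    have h1 : Tendsto (fun n : ℕ => (√(n : ℝ))⁻¹ * ‖s‖) atTop (𝓝 (0 * ‖s‖)) :=
      (tendsto_inv_atTop_zero.comp
        (Real.tendsto_sqrt_atTop.comp tendsto_natCast_atTop_atTop)).mul_const _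
    simpa using (hω.norm.add h1).const_mul (2 / c)
  have hev : ∀ᵐ ω ∂P, ∀ᶠ n in atTop, ω ∈ H n := by
    filter_upwards [hr0, hcov] with ω h1 h2
    have h3 : Tendsto (fun n => ‖S n ω - T‖) atTop (𝓝 0) := by
      simpa using (h2.sub_const T).norm
    filter_upwards [eventually_gt_atTop 0, h3.eventually (ge_mem_nhds hc),
      h1.eventually (gt_mem_nhds hδ0)] with n k1 k2 k3
    exact ⟨k1, k2, k3⟩
  have hkey : ∀ n, ∀ᵐ ω ∂P, ω ∈ H n → ‖U n ω‖ ≤ 2 / c * (‖Z n ω‖ + ‖s‖) ∧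
      ‖βhat n ω - β₀‖ ≤ r n ω ∧
      ∀ K, Z n ω + (T - S n ω) (U n ω) - gradient g (βhat n ω) ∈
        solutionSet (activeFamily v β₀) T K ↔ U n ω ∈ K := fun n => by
    filter_upwards [hβ n] with ω hω h
    exact mem_solutionSet_iff_of_isMinOn_objective hg_smooth hs hδ hc hT h.1 h.2.1 h.2.2 hω
  have hβ_lim : ∀ᵐ ω ∂P, Tendsto (fun n => βhat n ω) atTop (𝓝 β₀) := by
    filter_upwards [hr0, hev, ae_all_iff.2 hkey] with ω h1 h2 h3
    rw [tendsto_iff_norm_sub_tendsto_zero]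
    refine squeeze_zero' (.of_forall fun n => norm_nonneg _) ?_ h1
    filter_upwards [h2] with n hn
    exact (h3 n hn).2.1
  have hUm : ∀ n, AEMeasurable (U n) P := fun n =>
    ((hβ_meas n).sub_const β₀).fun_const_smul _
  -- Off `H n` nothing controls `U n`, hence the indicator. Now `Q n` is almost surely bounded by
  -- `‖T - S n‖` times an affine function of `‖Z n‖`, which tends to zero in distribution by
  -- Slutsky.
  set Q : ℕ → Ω → EuclideanSpace ℝ (Fin p) :=
    fun n => (H n).indicator fun ω => (T - S n ω) (U n ω) with hQdef
  have hQm : ∀ n, AEMeasurable (Q n) P := fun n =>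
    (aemeasurable_clm_apply ((hSm n).const_sub T) (hUm n)).indicator (hHm n)
  have hQ : TendstoInMeasure P Q atTop fun _ => 0 := by
    have hSn : ∀ n, Measurable fun ω => ‖T - S n ω‖ := fun n => ((hSm n).const_sub T).norm
    have hS0 : TendstoInMeasure P (fun n ω => ‖T - S n ω‖) atTop fun _ => (0 : ℝ) := by
      refine tendstoInMeasure_of_tendsto_ae (fun n => (hSn n).aestronglyMeasurable) ?_
      filter_upwards [hcov] with ω hω
      simpa using (hω.const_sub T).norm
    have hD := hscore.continuous_comp_prodMk_of_tendstoInMeasure_const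
      (g := fun z : EuclideanSpace ℝ (Fin p) × ℝ => z.2 * (2 / c * (‖z.1‖ + ‖s‖)))
      (by fun_prop) hS0 fun n => (hSn n).aemeasurable
    simp only [zero_mul] at hD
    refine tendstoInMeasure_zero_of_norm_le
      (tendstoInMeasure_of_tendstoInDistribution_zero hD) fun n => ?_
    filter_upwards [hkey n] with ω hω
    by_cases h : ω ∈ H n
    · rw [hQdef]
      simp only [Set.indicator_of_mem h]
      exact ((T - S n ω).le_opNorm _).trans
        (mul_le_mul_of_nonneg_left (hω h).1 (norm_nonneg _))
    · rw [hQdef]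
      simp only [Set.indicator_of_notMem h, norm_zero]
      positivity
  have hgm := (continuous_gradient hg_smooth).measurable
  have hG : TendstoInMeasure P (fun n ω => -gradient g (βhat n ω)) atTop
      fun _ => -gradient g β₀ := by
    refine tendstoInMeasure_of_tendsto_ae
      (fun n => (hgm.comp_aemeasurable (hβ_meas n)).neg.aestronglyMeasurable) ?_
    filter_upwards [hβ_lim] with ω hω
    exact (((continuous_gradient hg_smooth).tendsto β₀).comp hω).neg
  have hY := (hscore.add_of_tendstoInMeasure_const hQ hQm).add_of_tendstoInMeasure_const hG
    fun n => (hgm.comp_aemeasurable (hβ_meas n)).neg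
  simp only [add_zero, ← sub_eq_add_neg] at hY
  set A := solutionSet (activeFamily v β₀) T K with hAdef
  have hA : P'.map (fun ω => W ω - gradient g β₀) (frontier A) = 0 := by
    -- Translation by the gradient preserves Lebesgue measure, so the null frontier stays null for
    -- the shifted Gaussian.
    have hac : P'.map W ≪ volume := by
      rw [hW.map_eq]
      exact multivariateGaussian_absolutelyContinuous (hC.smul hτ)
    rw [Measure.map_apply_of_aemeasurable hY.aemeasurable_limit isClosed_frontier.measurableSet]
    have hpre : (fun ω => W ω - gradient g β₀) ⁻¹' frontier A =
        W ⁻¹' ((fun w => w - gradient g β₀) ⁻¹' frontier A) := rfl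
    rw [hpre, ← Measure.map_apply_of_aemeasurable hW.aemeasurable
      ((measurable_sub_const _) isClosed_frontier.measurableSet)]
    refine hac ?_
    rw [(measurePreserving_sub_right volume (gradient g β₀)).measure_preimage
      isClosed_frontier.measurableSet.nullMeasurableSet]
    exact volume_frontier_solutionSet _ _ hK
  have hHc : Tendsto (fun n => P (H n)ᶜ) atTop (𝓝 0) := by
    have h := tendsto_measure_of_ae_tendsto_indicator_of_isFiniteMeasure (μ := P) atTop
      MeasurableSet.empty (fun n => (hHm n).compl) (by
        filter_upwards [hev] with ω hω
        filter_upwards [hω] with n hn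
        simpa using hn)
    simpa using h
  have hfinal := tendsto_measure_of_ae_iff hY hA (B := fun n => {ω | U n ω ∈ K}) hHc fun n => by
    filter_upwards [hkey n] with ω hω h
    rw [← (hω h).2.2 K]
    simp [hQdef, h, sub_eq_add_neg, hAdef]
  have huK : P' {ω | uhat ω ∈ K} = P' {ω | W ω - gradient g β₀ ∈ A} := by
    refine measure_congr ?_
    filter_upwards [huhat] with ω hω
    have h := isSubgradient_of_isMinOn_limitObjective v hg_smooth hC.1 hω
    exact propext (mem_solutionSet_iff hTpos h).symm
  rw [huK]
  exact hfinal

end PatternConv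

theorem theorem2 {p : ℕ} {ι : Type*} [Fintype ι] [Nonempty ι]
    {Ω : Type*} [MeasurableSpace Ω] (P : Measure Ω) [IsProbabilityMeasure P]
    {Ω' : Type*} [MeasurableSpace Ω'] (P' : Measure Ω') [IsProbabilityMeasure P']
    -- the penalty `f = max_i ⟪v i, ·⟫ + g`
    (v : ι → EuclideanSpace ℝ (Fin p)) (g : EuclideanSpace ℝ (Fin p) → ℝ)
    (hg_convex : ConvexOn ℝ Set.univ g) (hg_smooth : ContDiff ℝ 1 g)
    -- the linear model
    (β₀ : EuclideanSpace ℝ (Fin p)) (C : Matrix (Fin p) (Fin p) ℝ) (hC : C.PosDef)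
    (σ : ℝ) (hσ : 0 < σ)
    (X : ℕ → Ω → EuclideanSpace ℝ (Fin p)) (ε : ℕ → Ω → ℝ)
    (hX_meas : ∀ i, Measurable (X i)) (hε_meas : ∀ i, Measurable (ε i))
    (hX_indep : iIndepFun X P) (hX_ident : ∀ i, IdentDistrib (X i) (X 0) P P)
    (hX_L2 : MemLp (X 0) 2 P) (hX_mean : ∫ ω, X 0 ω ∂P = 0)
    (hX_cov : ∀ j k, cov[fun ω => X 0 ω j, fun ω => X 0 ω k; P] = C j k)
    (hε_indep : iIndepFun ε P) (hε_ident : ∀ i, IdentDistrib (ε i) (ε 0) P P)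
    (hε_L2 : MemLp (ε 0) 2 P) (hε_mean : ∫ ω, ε 0 ω ∂P = 0) (hε_var : Var[ε 0; P] = σ ^ 2)
    (hXε : IndepFun (fun ω i => X i ω) (fun ω i => ε i ω) P)
    -- `βhat n` is a random vector that minimizes the objective (whenever a minimizer exists)
    (βhat : ℕ → Ω → EuclideanSpace ℝ (Fin p)) (hβ_meas : ∀ n, AEMeasurable (βhat n) P)
    (hβ : ∀ n, ∀ᵐ ω ∂P,
      (∃ b, IsMinOn (PatternConv.objective (PatternConv.penalty v g) β₀
        (fun i => X i ω) (fun i => ε i ω) n) Set.univ b) →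
      IsMinOn (PatternConv.objective (PatternConv.penalty v g) β₀
        (fun i => X i ω) (fun i => ε i ω) n) Set.univ (βhat n ω))
    -- `uhat` minimizes the limiting objective, with `W ∼ N(0, σ² C)`
    (W : Ω' → EuclideanSpace ℝ (Fin p)) (hW : HasLaw W (multivariateGaussian 0 (σ ^ 2 • C)) P')
    (uhat : Ω' → EuclideanSpace ℝ (Fin p))
    (huhat : ∀ᵐ ω ∂P', IsMinOn
      (PatternConv.limitObjective (PatternConv.penalty v g) β₀ C (W ω)) Set.univ (uhat ω)) :
    (∀ K : Set (EuclideanSpace ℝ (Fin p)), Convex ℝ K →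
      Tendsto (fun n : ℕ => P {ω | √(n : ℝ) • (βhat n ω - β₀) ∈ K}) atTop
        (𝓝 (P' {ω | uhat ω ∈ K}))) ∧
    PatternConv.TendstoInPattern v (fun n ω => √(n : ℝ) • (βhat n ω - β₀)) uhat P P' ∧
    (∀ (m : ℕ) (w : Fin (m + 1) → EuclideanSpace ℝ (Fin p)),
      PatternConv.TendstoInPattern w (fun n ω => √(n : ℝ) • (βhat n ω - β₀)) uhat P P') := by
  obtain ⟨hscore, hscore_zero⟩ := PatternConv.tendstoInDistribution_score hX_meas hε_meas hX_indep
    hX_ident hX_L2 hX_mean hC.posSemidef hX_cov hε_indep hε_ident hε_L2 hε_mean hε_var hXε hW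
  have hcov := PatternConv.ae_tendsto_empiricalCov hX_indep hX_ident hX_L2 hX_mean hX_cov
  have hconv : ∀ K : Set (EuclideanSpace ℝ (Fin p)), Convex ℝ K →
      Tendsto (fun n : ℕ => P {ω | √(n : ℝ) • (βhat n ω - β₀) ∈ K}) atTop
        (𝓝 (P' {ω | uhat ω ∈ K})) := fun K hK =>
    PatternConv.tendsto_measure_minimizer_mem hg_convex hg_smooth hC (pow_pos hσ 2) hX_meas
      hε_meas hW hcov hscore hscore_zero hβ_meas hβ huhat hK
  exact ⟨hconv, fun 𝔭 _ => hconv _ (PatternConv.convex_setOf_pattern_eq v 𝔭),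
    fun m w 𝔭 _ => hconv _ (PatternConv.convex_setOf_pattern_eq w 𝔭)⟩
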